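/- Let $\mu\in C^1(\mathbb R)\cap L^\infty(\mathbb R)$ be even with $\mu'<0$ on $(0,\infty)$ and $\mu(\xi)=0$ for a (necessarily unique) $\xi>0$, let $f\in L^1(\mathbb R)\cap L^\infty(\mathbb R)\cap C(\mathbb R)$ be odd with $f>0$ on $(0,\infty)$, and let $a>0$. For $\epsilon>0$ and $u\in H^1(\mathbb R)$ put $$E_\epsilon(u)=\int_{\mathbb R}\Big(\frac{\epsilon}{2}|u'|^2-\frac{1}{2\epsilon}\mu u^2+\frac{1}{4\epsilon}u^4-a f u\Big)\,dx .$$ Let $\mu_1:=\mu'(\xi)<0$ and $\alpha:=\frac{a f(\xi)}{\sqrt2\,\mu_1}<0$, and for a function $v_\epsilon$ on $\mathbb R$ let $$w_\epsilon^{\pm}(s)=\pm2^{-1/2}(-\mu_1\epsilon)^{-1/3}\,v_\epsilon\Big(\pm\xi\pm\epsilon^{2/3}\frac{s}{(-\mu_1)^{1/3}}\Big).$$ A solution $y\in C^2(\mathbb R)$ of the second Painlevé equation $y''-sy-2y^3-\alpha=0$ on $\mathbb R$ is called minimal if $E_{\mathrm{P_{II}}}(y,\operatorname{supp}\phi)\le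 E_{\mathrm{P_{II}}}(y+\phi,\operatorname{supp}\phi)$ for all $\phi\in C_0^\infty(\mathbb R)$, where $E_{\mathrm{P_{II}}}(u,I)=\int_I\big(\tfrac12|u'|^2+\tfrac12su^2+\tfrac12u^4+\alpha u\big)\,ds$. Then there is exactly one minimal solution $y$ of this equation that is positive, satisfies $y'<0$ on $\mathbb R$, and has the asymptotics $y(s)\sim|\alpha|/s$ as $s\to+\infty$ and $y(s)\sim\sqrt{|s|/2}$ as $s\to-\infty$. Moreover: (1) if, for all sufficiently small $\epsilon>0$, $v_\epsilon$ is (the continuous representative of) a global minimizer of $E_\epsilon$ over $H^1(\mathbb R)$ with $v_\epsilon\ge0$ on $[0,\infty)$, then $w_\epsilon^+\to y$ in $C^1_{\mathrm{loc}}(\mathbb R)$ as $\epsilon\to0^+$; (2) if, for all sufficiently small $\epsilon>0$, $v_\epsilon$ is (the continuous representative of) a global minimizer of $E_\epsilon$ over $H^1(\mathbb R)$ with $v_\epsilon\le0$ on $(-\infty,0]$, then $w_\epsilon^-\to y$ in $C^1_{\mathrm{loc}}(\mathbb R)$ as $\epsilon\to0^+$. -/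

import Mathlib

open MeasureTheory Filter Topology Asymptotics
open scoped ContDiff

noncomputable section

/-- Standing assumptions on the coefficients: `μ ∈ C¹ ∩ L^∞` is even, `μ' < 0` on `(0, ∞)`,
`ξ > 0` is the (then unique) positive zero of `μ`; `f ∈ L¹ ∩ L^∞ ∩ C` is odd and positive
on `(0, ∞)`. -/
structure AdmissibleData (μ f : ℝ → ℝ) (ξ : ℝ) : Prop where
  contDiff_mu : ContDiff ℝ 1 μ
  bounded_mu : MemLp μ ⊤ volume
  even_mu : ∀ x, μ (-x) = μ x
  deriv_mu_neg : ∀ x, 0 < x → deriv μ x < 0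
  xi_pos : 0 < ξ
  mu_xi : μ ξ = 0
  integrable_f : Integrable f volume
  bounded_f : MemLp f ⊤ volume
  continuous_f : Continuous f
  odd_f : ∀ x, f (-x) = -f x
  f_pos : ∀ x, 0 < x → 0 < f x

/-- `u ∈ H¹(ℝ)` with weak derivative `g`: both are in `L²(ℝ)` and
`∫ u φ' = -∫ g φ` for every test function `φ`. -/
structure IsH1WithWeakDeriv (u g : ℝ → ℝ) : Prop where
  memLp : MemLp u 2 volume
  memLp_deriv : MemLp g 2 volume
  weak_deriv : ∀ φ : ℝ → ℝ, ContDiff ℝ ∞ φ → HasCompactSupport φ →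
    ∫ x, u x * deriv φ x = -∫ x, g x * φ x

/-- The energy `E(u)`, where `g` is the weak derivative of `u`. -/
def energy (μ f : ℝ → ℝ) (a ε : ℝ) (u g : ℝ → ℝ) : ℝ :=
  ∫ x, (ε / 2 * (g x) ^ 2 - 1 / (2 * ε) * μ x * (u x) ^ 2
    + 1 / (4 * ε) * (u x) ^ 4 - a * f x * u x)

/-- `v` is (the continuous representative of) a global minimizer of `E` over `H¹(ℝ)`. -/
def IsGlobalMinimizer (μ f : ℝ → ℝ) (a ε : ℝ) (v : ℝ → ℝ) : Prop :=
  Continuous v ∧ ∃ g, IsH1WithWeakDeriv v g ∧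
    ∀ u h, IsH1WithWeakDeriv u h → energy μ f a ε v g ≤ energy μ f a ε u h

/-- `y` is a classical solution of `y'' - s y - 2 y³ - α = 0` on `ℝ`. -/
def IsPainleveIISolution (α : ℝ) (y : ℝ → ℝ) : Prop :=
  ContDiff ℝ 2 y ∧ ∀ s, deriv (deriv y) s - s * y s - 2 * (y s) ^ 3 - α = 0

/-- The energy associated with the second Painlevé equation, on the set `I`. -/
def painleveEnergy (α : ℝ) (u : ℝ → ℝ) (I : Set ℝ) : ℝ :=
  ∫ s in I, (1 / 2 * (deriv u s) ^ 2 + 1 / 2 * s * (u s) ^ 2 + 1 / 2 * (u s) ^ 4 + α * u s)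

/-- Minimal solutions: compactly supported smooth perturbations do not lower the energy. -/
def IsMinimalPainleveIISolution (α : ℝ) (y : ℝ → ℝ) : Prop :=
  IsPainleveIISolution α y ∧
    ∀ φ : ℝ → ℝ, ContDiff ℝ ∞ φ → HasCompactSupport φ →
      painleveEnergy α y (tsupport φ) ≤ painleveEnergy α (fun s => y s + φ s) (tsupport φ)

/-- For `α < 0`: the positive, strictly decreasing minimal solution with
`y(s) ∼ |α| / s` at `+∞` and `y(s) ∼ √(|s| / 2)` at `-∞`. -/
structure IsPositiveDecreasingPainleve (α : ℝ) (y : ℝ → ℝ) : Prop where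
  minimal : IsMinimalPainleveIISolution α y
  pos : ∀ s, 0 < y s
  deriv_neg : ∀ s, deriv y s < 0
  asymp_atTop : y ~[atTop] fun s => |α| / s
  asymp_atBot : y ~[atBot] fun s => √(|s| / 2)

/-- The rescaled profile
`w(s) = σ 2^{-1/2} (-μ'(ξ) ε)^{-1/3} v(σ ξ + σ ε^{2/3} s / (-μ'(ξ))^{1/3})`;
`σ = 1` gives `w⁺` and `σ = -1` gives `w⁻`. -/
def rescaledProfile (μ : ℝ → ℝ) (ξ σ ε : ℝ) (v : ℝ → ℝ) (s : ℝ) : ℝ :=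
  σ * (2 : ℝ) ^ (-(1 / 2) : ℝ) * (-(deriv μ ξ) * ε) ^ (-(1 / 3) : ℝ) *
    v (σ * ξ + σ * ε ^ (2 / 3 : ℝ) * (s / (-(deriv μ ξ)) ^ (1 / 3 : ℝ)))

/-- Convergence `w ε → y` in `C¹_loc(ℝ)` as `ε → 0⁺`. -/
def TendstoC1Loc (w : ℝ → ℝ → ℝ) (y : ℝ → ℝ) : Prop :=
  ContDiff ℝ 1 y ∧ (∀ᶠ ε in 𝓝[>] (0 : ℝ), ContDiff ℝ 1 (w ε)) ∧
    TendstoLocallyUniformly w y (𝓝[>] 0) ∧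
    TendstoLocallyUniformly (fun ε => deriv (w ε)) (deriv y) (𝓝[>] 0)

end

/-!
Near the zero `ξ` of `μ` a minimizer, rescaled by `ε^{2/3}` in length and by `ε^{1/3}` in size,
solves the second Painlevé equation `y'' = s y + 2 y³ - β`, `β = -α > 0`, up to an error that is
small on compact sets. The cubic term gives a Keller–Osserman bound: a nonnegative approximate
solution is bounded on each compact set by a constant depending on the set only. Hence the rescaled
minimizers are precompact in `C¹_loc`, and each of their limits is a nonnegative solution on `ℝ`.

There is only one such solution, so the whole family converges. Indeed local barriers show that
every nonnegative solution is asymptotic to `β / s` at `+∞` and to `√(|s| / 2)` at `-∞`. The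
quotient `u / y` of two solutions therefore tends to `1` at both ends, and at an interior maximum
`u'' / u ≤ y'' / y`, that is, `2 u² - β / u ≤ 2 y² - β / y`, which forces `u ≤ y`. Comparing `y`
with its translates in the same way gives its monotonicity, and its minimality follows from Picone's
identity, which uses only that `y > 0`. Existence is obtained by solving Dirichlet problems on
growing intervals by shooting.
-/

section MaximumPrinciple

theorem second_deriv_nonpos_of_isLocalMax {u u' : ℝ → ℝ} {c d : ℝ} (hmax : IsLocalMax u c)
    (hu : ∀ᶠ t in 𝓝 c, HasDerivAt u (u' t) t) (hu' : HasDerivAt u' d c) : d ≤ 0 := by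
  by_contra! hd
  have hderiv : deriv u =ᶠ[𝓝 c] u' := hu.mono fun t ht => ht.deriv
  have hmin : IsLocalMin u c :=
    isLocalMin_of_deriv_deriv_pos (by rwa [hderiv.deriv_eq, hu'.deriv]) hmax.deriv_eq_zero
      hu.self_of_nhds.continuousAt
  have hconst : u =ᶠ[𝓝 c] fun _ => u c := by
    filter_upwards [hmin, hmax] with t using fun h₁ h₂ => le_antisymm h₂ h₁
  have hzero : u' =ᶠ[𝓝 c] fun _ => 0 := by
    filter_upwards [hconst.eventually_nhds, hu] with t ht hut
    exact hut.unique ((hasDerivAt_const t (u c)).congr_of_eventuallyEq ht)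
  exact hd.ne' (hu'.unique ((hasDerivAt_const c 0).congr_of_eventuallyEq hzero))

theorem exists_mem_Ioo_isMaxOn_of_pos {u : ℝ → ℝ} {a b x₀ : ℝ}
    (hu : ContinuousOn u (Set.Icc a b)) (ha : u a ≤ 0) (hb : u b ≤ 0)
    (hx₀ : x₀ ∈ Set.Icc a b) (hpos : 0 < u x₀) :
    ∃ x ∈ Set.Ioo a b, IsMaxOn u (Set.Icc a b) x := by
  obtain ⟨x, hx, hmax⟩ := isCompact_Icc.exists_isMaxOn ⟨x₀, hx₀⟩ hu
  have hux : 0 < u x := hpos.trans_le (hmax hx₀)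
  exact ⟨x, ⟨hx.1.lt_of_ne fun h => ha.not_gt (h ▸ hux),
    hx.2.lt_of_ne fun h => hb.not_gt (h ▸ hux)⟩, hmax⟩

theorem exists_critical_isMaxOn_of_pos {u u' u'' : ℝ → ℝ} {a b x₀ : ℝ}
    (hcont : ContinuousOn u (Set.Icc a b)) (hu : ∀ s ∈ Set.Ioo a b, HasDerivAt u (u' s) s)
    (hu' : ∀ s ∈ Set.Ioo a b, HasDerivAt u' (u'' s) s) (ha : u a ≤ 0) (hb : u b ≤ 0)
    (hx₀ : x₀ ∈ Set.Icc a b) (hpos : 0 < u x₀) :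
    ∃ x ∈ Set.Ioo a b, u x₀ ≤ u x ∧ u' x = 0 ∧ u'' x ≤ 0 := by
  obtain ⟨x, hx, hmax⟩ := exists_mem_Ioo_isMaxOn_of_pos hcont ha hb hx₀ hpos
  have hlocal : IsLocalMax u x := hmax.isLocalMax (Icc_mem_nhds hx.1 hx.2)
  exact ⟨x, hx, hmax hx₀, hlocal.hasDerivAt_eq_zero (hu x hx),
    second_deriv_nonpos_of_isLocalMax hlocal
      ((isOpen_Ioo.eventually_mem hx).mono hu) (hu' x hx)⟩

theorem second_deriv_le_of_isLocalMax_div {p p' y y' : ℝ → ℝ} {x p'' y'' : ℝ}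
    (hmax : IsLocalMax (fun s => p s / y s) x) (hpos : ∀ᶠ s in 𝓝 x, 0 < y s)
    (hp : ∀ᶠ s in 𝓝 x, HasDerivAt p (p' s) s) (hp' : HasDerivAt p' p'' x)
    (hy : ∀ᶠ s in 𝓝 x, HasDerivAt y (y' s) s) (hy' : HasDerivAt y' y'' x) :
    p'' ≤ p x / y x * y'' := by
  have htouch : IsLocalMax (fun s => p s - p x / y x * y s) x := by
    filter_upwards [hmax, hpos] with s hs hys
    rw [div_mul_cancel₀ _ hpos.self_of_nhds.ne', sub_self]
    exact sub_nonpos.2 ((div_le_iff₀ hys).1 hs)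
  refine sub_nonpos.1 (second_deriv_nonpos_of_isLocalMax htouch ?_ (hp'.sub (hy'.const_mul _)))
  filter_upwards [hp, hy] with s hps hys using hps.sub (hys.const_mul _)

theorem exists_second_deriv_le_div_mul {p p' p'' y y' y'' : ℝ → ℝ} {a b x₀ : ℝ}
    (hp : ∀ s ∈ Set.Icc a b, HasDerivAt p (p' s) s)
    (hp' : ∀ s ∈ Set.Icc a b, HasDerivAt p' (p'' s) s)
    (hy : ∀ s ∈ Set.Icc a b, HasDerivAt y (y' s) s)
    (hy' : ∀ s ∈ Set.Icc a b, HasDerivAt y' (y'' s) s) (hpos : ∀ s ∈ Set.Icc a b, 0 < y s)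
    (ha : p a = 0) (hb : p b = 0) (hx₀ : x₀ ∈ Set.Icc a b) (hpx₀ : 0 < p x₀) :
    ∃ x ∈ Set.Ioo a b, p x₀ / y x₀ ≤ p x / y x ∧ p'' x ≤ p x / y x * y'' x := by
  have hcont : ContinuousOn (fun s => p s / y s) (Set.Icc a b) := fun s hs =>
    ((hp s hs).continuousAt.div (hy s hs).continuousAt (hpos s hs).ne').continuousWithinAt
  obtain ⟨x, hx, hmax⟩ := exists_mem_Ioo_isMaxOn_of_pos hcont (by simp [ha]) (by simp [hb]) hx₀
    (div_pos hpx₀ (hpos x₀ hx₀))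
  have hxI : x ∈ Set.Icc a b := Set.Ioo_subset_Icc_self hx
  have hnhds : ∀ᶠ s in 𝓝 x, s ∈ Set.Icc a b := Icc_mem_nhds hx.1 hx.2
  exact ⟨x, hx, hmax hx₀, second_deriv_le_of_isLocalMax_div (hmax.isLocalMax hnhds)
    (hnhds.mono hpos) (hnhds.mono hp) (hp' x hxI) (hnhds.mono hy) (hy' x hxI)⟩

theorem le_of_second_deriv_ge_mul {u u' u'' : ℝ → ℝ} {c k M : ℝ} (hk : 0 < k) (hM : 0 ≤ M)
    (hu : ∀ s ∈ Set.Icc (c - 1) (c + 1), HasDerivAt u (u' s) s)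
    (hu' : ∀ s ∈ Set.Icc (c - 1) (c + 1), HasDerivAt u' (u'' s) s)
    (hode : ∀ s ∈ Set.Icc (c - 1) (c + 1), k * u s ≤ u'' s)
    (hbound : ∀ s ∈ Set.Icc (c - 1) (c + 1), u s ≤ M) : u c ≤ 2 * M / k := by
  by_contra! hlt
  have hB : 0 ≤ 2 * M / k := by positivity
  -- The parabola `2 M / k + M (s - c) ^ 2` is a supersolution lying above `u` at `c ± 1`.
  set v : ℝ → ℝ := fun s => u s - M * (s - c) ^ 2 - 2 * M / k with hv
  have hv' : ∀ s ∈ Set.Icc (c - 1) (c + 1), HasDerivAt v (u' s - 2 * M * (s - c)) s := fun s hs =>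
    (((hu s hs).sub ((((hasDerivAt_id s).sub_const c).pow 2).const_mul M)).sub_const _).congr_deriv
      (by simp; ring)
  have hv'' : ∀ s ∈ Set.Icc (c - 1) (c + 1),
      HasDerivAt (fun s => u' s - 2 * M * (s - c)) (u'' s - 2 * M) s := fun s hs =>
    ((hu' s hs).sub (((hasDerivAt_id s).sub_const c).const_mul (2 * M))).congr_deriv (by simp)
  obtain ⟨x, hx, hvx, -, hmax⟩ := exists_critical_isMaxOn_of_pos (x₀ := c)
    (fun s hs => (hv' s hs).continuousAt.continuousWithinAt)
    (fun s hs => hv' s (Set.Ioo_subset_Icc_self hs))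
    (fun s hs => hv'' s (Set.Ioo_subset_Icc_self hs))
    (by simp only [hv]; linarith [hbound (c - 1) ⟨by linarith, by linarith⟩])
    (by simp only [hv]; linarith [hbound (c + 1) ⟨by linarith, by linarith⟩])
    ⟨by linarith, by linarith⟩ (by simp only [hv]; linarith)
  have hux : 2 * M / k < u x := by
    simp only [hv] at hvx
    nlinarith [mul_nonneg hM (sq_nonneg (x - c))]
  rw [div_lt_iff₀ hk] at hux
  linarith [hode x (Set.Ioo_subset_Icc_self hx)]

/-- Keller–Osserman: the cubic term makes the bound independent of the values of `w` at `c ± 1`. -/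
theorem le_of_second_deriv_ge_cubic {w w' w'' : ℝ → ℝ} {c T b A : ℝ} (hA : 0 ≤ A)
    (hroot : 0 ≤ 2 * A ^ 3 - T * A - b) (hslope : T ≤ 6 * A ^ 2)
    (hw : ∀ s ∈ Set.Icc (c - 1) (c + 1), HasDerivAt w (w' s) s)
    (hw' : ∀ s ∈ Set.Icc (c - 1) (c + 1), HasDerivAt w' (w'' s) s)
    (hode : ∀ s ∈ Set.Icc (c - 1) (c + 1), 2 * w s ^ 3 - T * w s - b ≤ w'' s) :
    w c ≤ A + 2 := by
  by_contra! hlt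
  set v : ℝ → ℝ := fun s => (w s - A) * (1 - (s - c) ^ 2) with hv
  have hcut : ∀ s, HasDerivAt (fun s => 1 - (s - c) ^ 2) (-(2 * (s - c))) s := fun s =>
    ((((hasDerivAt_id s).sub_const c).pow 2).const_sub 1).congr_deriv (by simp)
  have hv' : ∀ s ∈ Set.Icc (c - 1) (c + 1),
      HasDerivAt v (w' s * (1 - (s - c) ^ 2) + (w s - A) * -(2 * (s - c))) s := fun s hs =>
    ((hw s hs).sub_const A).mul (hcut s)
  have hv'' : ∀ s ∈ Set.Icc (c - 1) (c + 1),
      HasDerivAt (fun s => w' s * (1 - (s - c) ^ 2) + (w s - A) * -(2 * (s - c)))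
        (w'' s * (1 - (s - c) ^ 2) - 4 * (s - c) * w' s - 2 * (w s - A)) s := fun s hs =>
    (((hw' s hs).mul (hcut s)).add (((hw s hs).sub_const A).mul
      ((((hasDerivAt_id s).sub_const c).const_mul 2).neg))).congr_deriv (by simp; ring)
  obtain ⟨x, hx, hvx, hcrit, hmax⟩ := exists_critical_isMaxOn_of_pos (x₀ := c)
    (fun s hs => (hv' s hs).continuousAt.continuousWithinAt)
    (fun s hs => hv' s (Set.Ioo_subset_Icc_self hs))
    (fun s hs => hv'' s (Set.Ioo_subset_Icc_self hs))
    (by simp [hv]) (by simp [hv]) ⟨by linarith, by linarith⟩ (by simp [hv]; linarith)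
  have hwx := hode x (Set.Ioo_subset_Icc_self hx)
  have hρ : 0 < 1 - (x - c) ^ 2 := by nlinarith [hx.1, hx.2]
  set q := w x - A with hq
  set ρ := 1 - (x - c) ^ 2 with hρdef
  have hqρ : 2 < q * ρ := by simp [hv] at hvx; linarith
  have hq0 : 0 < q := pos_of_mul_pos_left (by linarith) hρ.le
  have hcubic : 2 * q ^ 3 ≤ w'' x := by
    rw [show w x = A + q by ring] at hwx
    nlinarith [mul_nonneg hq0.le (sub_nonneg.2 hslope), mul_nonneg hA (sq_nonneg q)]
  have hmul : w'' x * ρ ^ 2 ≤ 8 * q := calc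
    w'' x * ρ ^ 2 = (w'' x * ρ - 4 * (x - c) * w' x - 2 * q) * ρ
        + 4 * (x - c) * (w' x * ρ + q * -(2 * (x - c))) + q * (8 - 6 * ρ) := by
      rw [hρdef]; ring
    _ ≤ 8 * q := by rw [hcrit]; nlinarith [mul_pos hq0 hρ]
  have hsq : q * (2 * (q * ρ) ^ 2) ≤ q * 8 := calc
    q * (2 * (q * ρ) ^ 2) = 2 * q ^ 3 * ρ ^ 2 := by ring
    _ ≤ w'' x * ρ ^ 2 := by gcongr
    _ ≤ q * 8 := by linarith
  nlinarith [le_of_mul_le_mul_left hsq hq0]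

theorem le_sq_of_second_deriv_le {y y' y'' : ℝ → ℝ} {c T : ℝ}
    (hy : ∀ s ∈ Set.Icc (c - 1) (c + 1), HasDerivAt y (y' s) s)
    (hy' : ∀ s ∈ Set.Icc (c - 1) (c + 1), HasDerivAt y' (y'' s) s)
    (hode : ∀ s ∈ Set.Icc (c - 1) (c + 1), y'' s ≤ -(T - 2 * y s ^ 2) * y s)
    (hpos : ∀ s ∈ Set.Icc (c - 1) (c + 1), 0 < y s) : T - 4 ≤ 2 * y c ^ 2 := by
  set p : ℝ → ℝ := fun s => (1 - (s - c) ^ 2) ^ 2 with hpdef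
  have hp : ∀ s, HasDerivAt p (-4 * (s - c) + 4 * (s - c) ^ 3) s := fun s =>
    (((((hasDerivAt_id s).sub_const c).pow 2).const_sub 1).pow 2).congr_deriv (by simp; ring)
  have hp' : ∀ s, HasDerivAt (fun s => -4 * (s - c) + 4 * (s - c) ^ 3)
      (-4 + 12 * (s - c) ^ 2) s := fun s =>
    ((((hasDerivAt_id s).sub_const c).const_mul (-4)).add
      ((((hasDerivAt_id s).sub_const c).pow 3).const_mul 4)).congr_deriv (by simp; ring)
  have hc : c ∈ Set.Icc (c - 1) (c + 1) := ⟨by linarith, by linarith⟩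
  obtain ⟨x, hx, hratio, htouch⟩ := exists_second_deriv_le_div_mul (fun s _ => hp s)
    (fun s _ => hp' s) hy hy' hpos (by simp [hpdef]) (by simp [hpdef]) hc (by simp [hpdef])
  have hxI : x ∈ Set.Icc (c - 1) (c + 1) := Set.Ioo_subset_Icc_self hx
  have hyx : 0 < y x := hpos x hxI
  have hρ : 0 < 1 - (x - c) ^ 2 := by nlinarith [hx.1, hx.2]
  have hpx0 : 0 < p x := pow_pos hρ 2
  have hpx1 : p x ≤ 1 := pow_le_one₀ hρ.le (by nlinarith [sq_nonneg (x - c)])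
  have hTp : (T - 2 * y x ^ 2) * p x ≤ 4 * p x := calc
    (T - 2 * y x ^ 2) * p x = -(p x / y x * (-(T - 2 * y x ^ 2) * y x)) := by field_simp
    _ ≤ -(p x / y x * y'' x) := by gcongr; exact hode x hxI
    _ ≤ 4 - 12 * (x - c) ^ 2 := by linarith
    _ ≤ 4 * p x := by simp only [hpdef]; nlinarith [sq_nonneg (x - c), sq_nonneg ((x - c) ^ 2)]
  have hT : T - 2 * y x ^ 2 ≤ 4 := le_of_mul_le_mul_right hTp hpx0
  have hyxc : y x ≤ y c := by
    rw [div_le_div_iff₀ (hpos c hc) hyx] at hratio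
    simp only [hpdef, sub_self] at hratio hpx1
    nlinarith [hpos c hc]
  nlinarith

end MaximumPrinciple

section Asymptotics

theorem isEquivalent_of_le_of_le {ι : Type*} {l : Filter ι} {f g u v : ι → ℝ} (hf : f ~[l] v)
    (hg : g ~[l] v) (hfu : f ≤ᶠ[l] u) (hug : u ≤ᶠ[l] g) : u ~[l] v := by
  refine IsBigO.trans_isLittleO (IsBigO.of_bound 1 ?_)
    (hf.isLittleO.norm_left.add hg.isLittleO.norm_left)
  filter_upwards [hfu, hug] with i hfui hugi
  simp only [Pi.sub_apply, Real.norm_eq_abs, one_mul]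
  refine (abs_le_max_abs_abs (sub_le_sub_right hfui (v i)) (sub_le_sub_right hugi (v i))).trans ?_
  exact (max_le_add_of_nonneg (abs_nonneg _) (abs_nonneg _)).trans (le_abs_self _)

theorem isEquivalent_sqrt {ι : Type*} {l : Filter ι} {u v : ι → ℝ} (h : u ~[l] v) (hv : 0 ≤ v) :
    (fun i => √(u i)) ~[l] fun i => √(v i) := by
  simpa only [Real.sqrt_eq_rpow] using! h.rpow hv (r := 1 / 2)

theorem isEquivalent_div_add_const {F : ℝ → ℝ} {β : ℝ} (hF : Tendsto F atTop (𝓝 β)) (hβ : β ≠ 0)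
    (c : ℝ) : (fun s => F s / (s + c)) ~[atTop] fun s => β / s :=
  ((isEquivalent_const_iff_tendsto hβ).2 hF).div
    (IsEquivalent.refl.add_const_of_norm_tendsto_atTop tendsto_norm_atTop_atTop)

theorem isEquivalent_sqrt_abs_add_const (c : ℝ) :
    (fun s => √(|s + c| / 2)) ~[atBot] fun s => √(|s| / 2) := by
  have habs : (fun s : ℝ => |s + c|) ~[atBot] fun s => |s| := by
    have hneg : (fun s : ℝ => -(s + c)) ~[atBot] fun s => -s :=
      (IsEquivalent.refl.add_const_of_norm_tendsto_atTop
        (by simpa using! tendsto_abs_atBot_atTop)).neg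
    refine (EventuallyEq.trans_isEquivalent ?_ hneg).trans_eventuallyEq ?_
    · filter_upwards [eventually_le_atBot (-c)] with s hs using abs_of_nonpos (by linarith)
    · filter_upwards [eventually_le_atBot 0] with s hs using (abs_of_nonpos hs).symm
  exact isEquivalent_sqrt (habs.div IsEquivalent.refl) fun s => by positivity

end Asymptotics

/-- `y` solves `y'' = s y + 2 y³ - β` on `ℝ`, with derivative `z`; this is the second Painlevé
equation with `α = -β`, and the sign makes `β = |α|` positive for `α < 0`. -/
structure PainleveODE (β : ℝ) (y z : ℝ → ℝ) : Prop where
  hasDerivAt : ∀ s, HasDerivAt y (z s) s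
  hasDerivAt_deriv : ∀ s, HasDerivAt z (s * y s + 2 * y s ^ 3 - β) s

namespace PainleveODE

section Basic

variable {β : ℝ} {y z : ℝ → ℝ}

theorem continuous (h : PainleveODE β y z) : Continuous y :=
  continuous_iff_continuousAt.2 fun s => (h.hasDerivAt s).continuousAt

theorem continuous_deriv (h : PainleveODE β y z) : Continuous z :=
  continuous_iff_continuousAt.2 fun s => (h.hasDerivAt_deriv s).continuousAt

theorem deriv_eq (h : PainleveODE β y z) : deriv y = z :=
  funext fun s => (h.hasDerivAt s).deriv

theorem pos_of_nonneg (h : PainleveODE β y z) (hβ : 0 < β) (hy : ∀ s, 0 ≤ y s) (s : ℝ) :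
    0 < y s := by
  refine (hy s).lt_of_ne fun h0 => ?_
  have hmax : IsLocalMax (fun t => -y t) s :=
    Eventually.of_forall fun t => by simpa [← h0] using hy t
  have hle := second_deriv_nonpos_of_isLocalMax hmax
    (Eventually.of_forall fun t => (h.hasDerivAt t).neg) (h.hasDerivAt_deriv s).neg
  norm_num [← h0] at hle
  linarith

theorem le_of_one_le (h : PainleveODE β y z) (hβ : 0 ≤ β) (hy : ∀ s, 0 ≤ y s) {s : ℝ}
    (hs : 1 ≤ s) : y s ≤ β + 3 := by
  have hle := le_of_second_deriv_ge_cubic (w := y) (c := s) (T := 0) (b := β) (A := 1 + β)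
    (by positivity) (by ring_nf; positivity) (by positivity)
    (fun t _ => h.hasDerivAt t) (fun t _ => h.hasDerivAt_deriv t)
    (fun t ht => by nlinarith [mul_nonneg (by linarith [ht.1] : 0 ≤ t) (hy t)])
  linarith

theorem le_of_forall_Icc_le (h : PainleveODE β y z) (hβ : 0 ≤ β) (hy : ∀ s, 0 ≤ y s)
    {s M : ℝ} (hs : 1 < s) (hM : ∀ t ∈ Set.Icc (s - 1) (s + 1), y t ≤ M) :
    y s ≤ (β + 2 * M) / (s - 1) := by
  have hk : 0 < s - 1 := by linarith
  have hM0 : 0 ≤ M := (hy s).trans (hM s ⟨by linarith, by linarith⟩)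
  have hle := le_of_second_deriv_ge_mul (u := fun t => y t - β / (s - 1)) (c := s) hk hM0
    (fun t _ => (h.hasDerivAt t).sub_const _) (fun t _ => h.hasDerivAt_deriv t)
    (fun t ht => by
      rw [mul_sub, mul_div_cancel₀ _ hk.ne']
      nlinarith [mul_nonneg (sub_nonneg.2 ht.1) (hy t), pow_nonneg (hy t) 3])
    (fun t ht => (sub_le_self _ (by positivity)).trans (hM t ht))
  rw [add_div]
  linarith

theorem le_of_forall_Icc_ge (h : PainleveODE β y z) (hβ : 0 ≤ β) (hy : ∀ s, 0 ≤ y s)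
    {s M : ℝ} (hs : 0 ≤ s) (hM : ∀ t ∈ Set.Icc (s - 1) (s + 1), y t ≤ M) :
    (β - 2 * β / (s + (1 + 2 * M ^ 2))) / (s + (1 + 2 * M ^ 2)) ≤ y s := by
  set k := s + (1 + 2 * M ^ 2)
  have hk : 0 < k := by positivity
  have hle := le_of_second_deriv_ge_mul (u := fun t => β / k - y t) (c := s) (M := β / k) hk
    (by positivity) (fun t _ => (h.hasDerivAt t).const_sub _)
    (fun t _ => (h.hasDerivAt_deriv t).neg)
    (fun t ht => by
      have hsq : y t ^ 2 ≤ M ^ 2 := pow_le_pow_left₀ (hy t) (hM t ht) 2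
      rw [mul_sub, mul_div_cancel₀ _ hk.ne']
      nlinarith [mul_nonneg (sub_nonneg.2 ht.2) (hy t), mul_nonneg (sub_nonneg.2 hsq) (hy t)])
    (fun t _ => sub_le_self _ (hy t))
  rw [sub_div, mul_div_assoc]
  linarith

theorem sqrt_le_of_le_neg_five (h : PainleveODE β y z) (hβ : 0 ≤ β) (hy : ∀ s, 0 < y s) {s : ℝ}
    (hs : s ≤ -5) : √(|s + 5| / 2) ≤ y s := by
  have hle := le_sq_of_second_deriv_le (y := y) (c := s) (T := -s - 1)
    (fun t _ => h.hasDerivAt t) (fun t _ => h.hasDerivAt_deriv t)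
    (fun t ht => by nlinarith [mul_nonneg (sub_nonneg.2 ht.2) (hy t).le]) (fun t _ => hy t)
  rw [Real.sqrt_le_left (hy s).le, abs_of_nonpos (by linarith)]
  linarith

theorem le_sqrt_add_of_le_neg_five (h : PainleveODE β y z) (hβ : 0 ≤ β) (hy : ∀ s, 0 ≤ y s)
    {s : ℝ} (hs : s ≤ -5) : y s ≤ √(|s - 2| / 2) + (β + 2) := by
  set r := √(|s - 2| / 2) with hr
  have hr0 : 0 ≤ r := Real.sqrt_nonneg _
  have hr2 : r ^ 2 = (-s + 2) / 2 := by
    rw [hr, Real.sq_sqrt (by positivity), abs_of_nonpos (by linarith)]; ring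
  have hT : -s + 1 ≤ 2 * (r + β) ^ 2 - 1 := by nlinarith
  have hle := le_of_second_deriv_ge_cubic (w := y) (c := s) (T := -s + 1) (b := β) (A := r + β)
    (by positivity)
    (by nlinarith [mul_nonneg (add_nonneg hr0 hβ) (sub_nonneg.2 hT)])
    (by nlinarith [sq_nonneg (r + β)])
    (fun t _ => h.hasDerivAt t) (fun t _ => h.hasDerivAt_deriv t)
    (fun t ht => by nlinarith [mul_nonneg (sub_nonneg.2 ht.1) (hy t)])
  linarith

theorem isEquivalent_atTop (h : PainleveODE β y z) (hβ : 0 < β) (hy : ∀ s, 0 ≤ y s) :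
    y ~[atTop] fun s => β / s := by
  set C := β + 2 * (β + 3)
  have hC0 : 0 ≤ C := by positivity
  have hbound : ∀ s, 2 ≤ s → y s ≤ C / (s - 1) := fun s hs =>
    h.le_of_forall_Icc_le hβ.le hy (by linarith) fun t ht =>
      h.le_of_one_le hβ.le hy (by linarith [ht.1])
  set κ := 1 + 2 * (β + 3) ^ 2
  have hzero : ∀ b c : ℝ, Tendsto (fun s : ℝ => b / (s + c)) atTop (𝓝 0) := fun b c =>
    tendsto_const_nhds.div_atTop (tendsto_atTop_add_const_right _ c tendsto_id)
  have hlow : (fun s => (β - 2 * β / (s + κ)) / (s + κ)) ~[atTop] fun s => β / s :=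
    isEquivalent_div_add_const (by simpa using (hzero (2 * β) κ).const_sub β) hβ.ne' κ
  have hup : (fun s => (β + 2 * (C / (s + -2))) / (s + -1)) ~[atTop] fun s => β / s :=
    isEquivalent_div_add_const (by simpa using ((hzero C (-2)).const_mul 2).const_add β) hβ.ne' (-1)
  refine isEquivalent_of_le_of_le hlow hup ?_ ?_
  · filter_upwards [eventually_ge_atTop 2] with s hs
    exact h.le_of_forall_Icc_ge hβ.le hy (by linarith) fun t ht =>
      h.le_of_one_le hβ.le hy (by linarith [ht.1])
  · filter_upwards [eventually_ge_atTop 3] with s hs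
    exact h.le_of_forall_Icc_le hβ.le hy (by linarith) fun t ht =>
      (hbound t (by linarith [ht.1])).trans
        (div_le_div_of_nonneg_left hC0 (by linarith) (by linarith [ht.1]))

theorem isEquivalent_atBot (h : PainleveODE β y z) (hβ : 0 ≤ β) (hy : ∀ s, 0 < y s) :
    y ~[atBot] fun s => √(|s| / 2) := by
  have hatTop : Tendsto (fun s : ℝ => ‖√(|s| / 2)‖) atBot atTop :=
    tendsto_norm_atTop_atTop.comp (Real.tendsto_sqrt_atTop.comp
      (tendsto_abs_atBot_atTop.atTop_div_const two_pos))
  refine isEquivalent_of_le_of_le (isEquivalent_sqrt_abs_add_const 5)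
    ((isEquivalent_sqrt_abs_add_const (-2)).add_const_of_norm_tendsto_atTop (c := β + 2) hatTop)
    ?_ ?_
  · filter_upwards [eventually_le_atBot (-5)] with s hs using h.sqrt_le_of_le_neg_five hβ hy hs
  · filter_upwards [eventually_le_atBot (-5)] with s hs
    exact h.le_sqrt_add_of_le_neg_five hβ (fun t => (hy t).le) hs

end Basic

section Comparison

variable {β : ℝ} {y z : ℝ → ℝ}

theorem le_of_subsolution (h : PainleveODE β y z) (hβ : 0 ≤ β) (hy : ∀ s, 0 < y s)
    {u u' u'' : ℝ → ℝ} (hu : ∀ s, HasDerivAt u (u' s) s) (hu' : ∀ s, HasDerivAt u' (u'' s) s)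
    (hsub : ∀ s, s * u s + 2 * u s ^ 3 - β ≤ u'' s)
    (htop : u ~[atTop] y) (hbot : u ~[atBot] y) (s : ℝ) : u s ≤ y s := by
  have hlim {l : Filter ℝ} (hl : u ~[l] y) : Tendsto (fun t => u t / y t) l (𝓝 1) :=
    (isEquivalent_iff_tendsto_one (Eventually.of_forall fun t => (hy t).ne')).1 hl
  by_contra! hs
  have hgt : 1 < u s / y s := (one_lt_div (hy s)).2 hs
  have hcont : Continuous fun t => u t / y t :=
    .div (continuous_iff_continuousAt.2 fun t => (hu t).continuousAt) h.continuous
      fun t => (hy t).ne'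
  obtain ⟨x, hx⟩ := hcont.exists_forall_ge' s (by
    rw [cocompact_eq_atBot_atTop, eventually_sup]
    exact ⟨((hlim hbot).eventually_lt_const hgt).mono fun t ht => ht.le,
      ((hlim htop).eventually_lt_const hgt).mono fun t ht => ht.le⟩)
  have hmax : u'' x ≤ u x / y x * (x * y x + 2 * y x ^ 3 - β) :=
    second_deriv_le_of_isLocalMax_div (Eventually.of_forall hx) (Eventually.of_forall hy)
      (Eventually.of_forall hu) (hu' x) (Eventually.of_forall h.hasDerivAt) (h.hasDerivAt_deriv x)
  have hc1 : 1 < u x / y x := hgt.trans_le (hx s)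
  have hsubx := hsub x
  rw [← div_mul_cancel₀ (u x) (hy x).ne'] at hsubx
  set c := u x / y x
  -- `c y` is a strict supersolution because `c > 1` and the cubic term is superlinear.
  have hstrict : 0 < (c ^ 3 - c) * y x ^ 3 :=
    mul_pos (by nlinarith [mul_pos (sub_pos.2 hc1) (zero_lt_one.trans hc1)]) (pow_pos (hy x) 3)
  nlinarith [mul_nonneg (sub_nonneg.2 hc1.le) hβ]

theorem le_of_nonneg (h : PainleveODE β y z) (hβ : 0 < β) (hy : ∀ s, 0 ≤ y s) {u v : ℝ → ℝ}
    (hu : PainleveODE β u v) (hu₀ : ∀ s, 0 ≤ u s) (s : ℝ) : u s ≤ y s :=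
  have hpos := h.pos_of_nonneg hβ hy
  h.le_of_subsolution hβ.le hpos hu.hasDerivAt hu.hasDerivAt_deriv (fun _ => le_rfl)
    ((hu.isEquivalent_atTop hβ hu₀).trans (h.isEquivalent_atTop hβ hy).symm)
    ((hu.isEquivalent_atBot hβ.le (hu.pos_of_nonneg hβ hu₀)).trans
      (h.isEquivalent_atBot hβ.le hpos).symm) s

theorem eq_of_nonneg (h : PainleveODE β y z) (hβ : 0 < β) (hy : ∀ s, 0 ≤ y s) {u v : ℝ → ℝ}
    (hu : PainleveODE β u v) (hu₀ : ∀ s, 0 ≤ u s) : u = y :=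
  funext fun s => (h.le_of_nonneg hβ hy hu hu₀ s).antisymm (hu.le_of_nonneg hβ hu₀ h hy s)

theorem antitone_of_nonneg (h : PainleveODE β y z) (hβ : 0 < β) (hy : ∀ s, 0 ≤ y s) :
    Antitone y := by
  have hpos := h.pos_of_nonneg hβ hy
  have htop := h.isEquivalent_atTop hβ hy
  have hbot := h.isEquivalent_atBot hβ.le hpos
  suffices ∀ τ, 0 ≤ τ → ∀ s, y (s + τ) ≤ y s from fun s t hst => by
    simpa using this (t - s) (sub_nonneg.2 hst) s
  intro τ hτ
  -- The translate `y (· + τ)` is a subsolution with the same asymptotics as `y`.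
  refine h.le_of_subsolution hβ.le hpos (fun s => (h.hasDerivAt (s + τ)).comp_add_const s τ)
    (fun s => (h.hasDerivAt_deriv (s + τ)).comp_add_const s τ)
    (fun s => by nlinarith [mul_nonneg hτ (hy (s + τ))]) ?_ ?_
  · exact ((htop.comp_tendsto (tendsto_atTop_add_const_right _ τ tendsto_id)).trans
      (isEquivalent_div_add_const tendsto_const_nhds hβ.ne' τ)).trans htop.symm
  · exact ((hbot.comp_tendsto (tendsto_atBot_add_const_right _ τ tendsto_id)).trans
      (isEquivalent_sqrt_abs_add_const τ)).trans hbot.symm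

theorem deriv_neg_of_nonneg (h : PainleveODE β y z) (hβ : 0 < β) (hy : ∀ s, 0 ≤ y s) (s : ℝ) :
    z s < 0 := by
  have hle : ∀ t, z t ≤ 0 := fun t => by
    rw [← h.deriv_eq]; exact (h.antitone_of_nonneg hβ hy).deriv_nonpos
  refine (hle s).lt_of_ne fun h0 => ?_
  have hmax : IsLocalMax z s := Eventually.of_forall fun t => by rw [h0]; exact hle t
  have hz'' : HasDerivAt (fun t => t * y t + 2 * y t ^ 3 - β)
      (y s + s * z s + 6 * y s ^ 2 * z s) s :=
    ((((hasDerivAt_id s).mul (h.hasDerivAt s)).add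
      (((h.hasDerivAt s).pow 3).const_mul 2)).sub_const β).congr_deriv (by simp; ring)
  have := second_deriv_nonpos_of_isLocalMax hmax (Eventually.of_forall h.hasDerivAt_deriv) hz''
  rw [h0] at this
  linarith [h.pos_of_nonneg hβ hy s]

end Comparison

end PainleveODE

theorem setIntegral_eq_zero_of_hasDerivAt {F F' : ℝ → ℝ} {K : Set ℝ} (hK : IsCompact K)
    (hF : ∀ s, HasDerivAt F (F' s) s) (hF' : Continuous F') (hzero : ∀ s ∉ K, F s = 0) :
    ∫ s in K, F' s = 0 := by
  have hzero' : ∀ s ∉ K, F' s = 0 := fun s hs =>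
    (hF s).unique ((hasDerivAt_const s 0).congr_of_eventuallyEq
      ((hK.isClosed.isOpen_compl.eventually_mem hs).mono hzero))
  have hFc : Continuous F := continuous_iff_continuousAt.2 fun s => (hF s).continuousAt
  rw [setIntegral_eq_integral_of_forall_compl_eq_zero hzero']
  exact integral_eq_zero_of_hasDerivAt_of_integrable hF
    (hF'.integrable_of_hasCompactSupport (.intro hK hzero'))
    (hFc.integrable_of_hasCompactSupport (.intro hK hzero))

theorem contDiff_one_of_hasDerivAt {u u' : ℝ → ℝ} (hu : ∀ s, HasDerivAt u (u' s) s)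
    (hu' : Continuous u') : ContDiff ℝ 1 u :=
  contDiff_one_iff_deriv.2
    ⟨fun s => (hu s).differentiableAt, by rwa [funext fun s => (hu s).deriv]⟩

theorem contDiff_two_of_hasDerivAt {u u' u'' : ℝ → ℝ} (hu : ∀ s, HasDerivAt u (u' s) s)
    (hu' : ∀ s, HasDerivAt u' (u'' s) s) (hu'' : Continuous u'') : ContDiff ℝ 2 u := by
  rw [← one_add_one_eq_two, contDiff_succ_iff_deriv, funext fun s => (hu s).deriv]
  exact ⟨fun s => (hu s).differentiableAt, by simp, contDiff_one_of_hasDerivAt hu' hu''⟩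

theorem IsPainleveIISolution.painleveODE {α : ℝ} {y : ℝ → ℝ} (h : IsPainleveIISolution α y) :
    PainleveODE (-α) y (deriv y) where
  hasDerivAt s := (h.1.differentiable two_ne_zero s).hasDerivAt
  hasDerivAt_deriv s := by
    have hderiv : ContDiff ℝ 1 (deriv y) :=
      (contDiff_succ_iff_deriv.1 (by rw [one_add_one_eq_two]; exact h.1)).2.2
    refine (hderiv.differentiable one_ne_zero s).hasDerivAt.congr_deriv ?_
    linarith [h.2 s]

namespace PainleveODE

section Minimality

variable {β : ℝ} {y z : ℝ → ℝ}

theorem isPainleveIISolution (h : PainleveODE β y z) : IsPainleveIISolution (-β) y := by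
  have hy := h.continuous
  refine ⟨contDiff_two_of_hasDerivAt h.hasDerivAt h.hasDerivAt_deriv (by fun_prop), fun s => ?_⟩
  rw [h.deriv_eq, (h.hasDerivAt_deriv s).deriv]
  ring

/-- Picone's identity: the difference of the energy densities of `y + φ` and `y` is an exact
derivative plus squares. -/
theorem hasDerivAt_picone (h : PainleveODE β y z) {φ : ℝ → ℝ} {p s : ℝ} (hy : y s ≠ 0)
    (hφ : HasDerivAt φ p s) :
    HasDerivAt (fun t => z t * φ t + φ t ^ 2 * (z t / y t) / 2)
      ((1 / 2 * (z s + p) ^ 2 + 1 / 2 * s * (y s + φ s) ^ 2 + 1 / 2 * (y s + φ s) ^ 4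
          + -β * (y s + φ s))
        - (1 / 2 * z s ^ 2 + 1 / 2 * s * y s ^ 2 + 1 / 2 * y s ^ 4 + -β * y s)
        - ((p - φ s * (z s / y s)) ^ 2 + φ s ^ 2 * (β / y s)
          + φ s ^ 2 * (2 * y s + φ s) ^ 2) / 2) s := by
  refine (((h.hasDerivAt_deriv s).mul hφ).add (((hφ.pow 2).mul
    ((h.hasDerivAt_deriv s).div (h.hasDerivAt s) hy)).div_const 2)).congr_deriv ?_
  simp only [Pi.pow_apply, Pi.div_apply]
  field_simp
  ring

theorem isMinimal (h : PainleveODE β y z) (hβ : 0 ≤ β) (hpos : ∀ s, 0 < y s) :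
    IsMinimalPainleveIISolution (-β) y := by
  refine ⟨h.isPainleveIISolution, fun φ hφ hφc => ?_⟩
  have hφ' : ∀ s, HasDerivAt φ (deriv φ s) s := fun s => (hφ.differentiable (by simp) s).hasDerivAt
  have hy := h.continuous
  have hz := h.continuous_deriv
  have hφcont : Continuous φ := hφ.continuous
  have hφ'cont : Continuous (deriv φ) := hφ.continuous_deriv (by simp)
  have hy0 : ∀ s, y s ≠ 0 := fun s => (hpos s).ne'
  have hderiv : deriv (fun t => y t + φ t) = fun s => z s + deriv φ s :=
    funext fun s => ((h.hasDerivAt s).add (hφ' s)).deriv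
  have hpicone := setIntegral_eq_zero_of_hasDerivAt hφc
    (fun s => h.hasDerivAt_picone (hy0 s) (hφ' s)) (by fun_prop (disch := assumption))
    (fun s hs => by simp [image_eq_zero_of_notMem_tsupport hs])
  have hintegrable {g : ℝ → ℝ} (hg : Continuous g) : IntegrableOn g (tsupport φ) :=
    hg.continuousOn.integrableOn_compact hφc
  rw [painleveEnergy, painleveEnergy, h.deriv_eq, hderiv, ← sub_nonneg,
    ← integral_sub (hintegrable (by fun_prop)) (hintegrable (by fun_prop)), ← hpicone]
  refine setIntegral_mono (hintegrable (by fun_prop (disch := assumption)))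
    (hintegrable (by fun_prop)) fun s => sub_le_self _ ?_
  have hys := hpos s
  positivity

theorem isPositiveDecreasing (h : PainleveODE β y z) (hβ : 0 < β) (hy : ∀ s, 0 ≤ y s) :
    IsPositiveDecreasingPainleve (-β) y where
  minimal := h.isMinimal hβ.le (h.pos_of_nonneg hβ hy)
  pos := h.pos_of_nonneg hβ hy
  deriv_neg s := h.deriv_eq ▸ h.deriv_neg_of_nonneg hβ hy s
  asymp_atTop := by simpa [abs_of_pos hβ] using h.isEquivalent_atTop hβ hy
  asymp_atBot := h.isEquivalent_atBot hβ.le (h.pos_of_nonneg hβ hy)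

end Minimality

end PainleveODE

section ContinuousConvergence

variable {ι α β : Type*} {F : Filter ι} {f : ι → α → β} {g : α → β}

theorem tendsto_of_tendsto_prod_nhds [TopologicalSpace α] [TopologicalSpace β] {x : α} {b : β}
    (h : Tendsto (fun p : ι × α => f p.1 p.2) (F ×ˢ 𝓝 x) (𝓝 b)) :
    Tendsto (fun i => f i x) F (𝓝 b) :=
  h.comp (tendsto_id.prodMk tendsto_const_nhds)

theorem continuous_of_forall_tendsto_prod_nhds [TopologicalSpace α] [PseudoMetricSpace β] [F.NeBot]
    (h : ∀ x, Tendsto (fun p : ι × α => f p.1 p.2) (F ×ˢ 𝓝 x) (𝓝 (g x))) : Continuous g := by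
  refine continuous_iff_continuousAt.2 fun x => Metric.tendsto_nhds.2 fun ε hε => ?_
  have hswap : ∀ᶠ p in 𝓝 x ×ˢ F, dist (f p.2 p.1) (g x) < ε / 2 :=
    tendsto_prod_swap.eventually (Metric.tendsto_nhds.1 (h x) (ε / 2) (half_pos hε))
  filter_upwards [hswap.curry] with t ht
  have hle : dist (g t) (g x) ≤ ε / 2 :=
    le_of_tendsto ((tendsto_of_tendsto_prod_nhds (h t)).dist tendsto_const_nhds)
      (ht.mono fun i hi => hi.le)
  linarith

theorem tendstoLocallyUniformly_of_forall_tendsto_prod_nhds [TopologicalSpace α]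
    [PseudoMetricSpace β]
    (h : ∀ x, Tendsto (fun p : ι × α => f p.1 p.2) (F ×ˢ 𝓝 x) (𝓝 (g x))) :
    TendstoLocallyUniformly f g F := by
  rcases F.eq_or_neBot with rfl | hF
  · exact fun u _ x => ⟨Set.univ, univ_mem, by simp⟩
  have hg : Continuous g := continuous_of_forall_tendsto_prod_nhds h
  exact tendstoLocallyUniformly_iff_forall_tendsto.2 fun x =>
    (((hg.tendsto x).comp tendsto_snd).prodMk_nhds (h x)).mono_right
      (nhds_le_uniformity (g x))

theorem tendsto_prod_nhds_of_lipschitzOnWith [PseudoMetricSpace α] [PseudoMetricSpace β]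
    {K : NNReal} {s : Set α} {x : α} {b : β} (hs : s ∈ 𝓝 x)
    (hlip : ∀ᶠ i in F, LipschitzOnWith K (f i) s) (hlim : Tendsto (fun i => f i x) F (𝓝 b)) :
    Tendsto (fun p : ι × α => f p.1 p.2) (F ×ˢ 𝓝 x) (𝓝 b) := by
  have hbound : Tendsto (fun p : ι × α => K * dist p.2 x + dist (f p.1 x) b) (F ×ˢ 𝓝 x)
      (𝓝 (K * dist x x + dist b b)) :=
    ((tendsto_snd.dist tendsto_const_nhds).const_mul _).add
      ((hlim.comp tendsto_fst).dist tendsto_const_nhds)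
  simp only [dist_self, mul_zero, add_zero] at hbound
  refine tendsto_iff_dist_tendsto_zero.2 (squeeze_zero' (Eventually.of_forall fun _ => dist_nonneg)
    ?_ hbound)
  filter_upwards [hlip.prod_mk hs] with p hp
  exact (dist_triangle _ (f p.1 x) _).trans
    (add_le_add_left (hp.1.dist_le_mul _ hp.2 _ (mem_of_mem_nhds hs)) _)

end ContinuousConvergence

theorem exists_tendsto_of_eventually_abs_le {ι : Type*} {U : Ultrafilter ι} {f : ι → ℝ} {M : ℝ}
    (hf : ∀ᶠ i in (U : Filter ι), |f i| ≤ M) : ∃ x, Tendsto f U (𝓝 x) := by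
  obtain ⟨x, -, hx⟩ := (isCompact_Icc (a := -M) (b := M)).ultrafilter_le_nhds (U.map f)
    (le_principal_iff.2 (hf.mono fun i hi => abs_le.1 hi))
  exact ⟨x, hx⟩

theorem abs_deriv_le_of_abs_second_deriv_le {f f' f'' : ℝ → ℝ} {s M : ℝ}
    (hf : ∀ t ∈ Set.Icc s (s + 1), HasDerivAt f (f' t) t)
    (hf' : ∀ t ∈ Set.Icc s (s + 1), HasDerivAt f' (f'' t) t)
    (hM : ∀ t ∈ Set.Icc s (s + 1), |f'' t| ≤ M) : |f' s| ≤ |f (s + 1) - f s| + M := by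
  obtain ⟨c, hc, hslope⟩ := exists_hasDerivAt_eq_slope f f' (lt_add_one s)
    (fun t ht => (hf t ht).continuousAt.continuousWithinAt)
    (fun t ht => hf t (Set.Ioo_subset_Icc_self ht))
  rw [add_sub_cancel_left, div_one] at hslope
  have hcI := Set.Ioo_subset_Icc_self hc
  have hdiff : |f' c - f' s| ≤ M * |c - s| :=
    (convex_Icc s (s + 1)).norm_image_sub_le_of_norm_hasDerivWithin_le
      (fun t ht => (hf' t ht).hasDerivWithinAt) hM (Set.left_mem_Icc.2 (by linarith)) hcI
  have hcs : |c - s| ≤ 1 := by rw [abs_le]; constructor <;> linarith [hc.1, hc.2]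
  have hM₀ : 0 ≤ M := (abs_nonneg _).trans (hM c hcI)
  rw [← hslope]
  calc |f' s| ≤ |f' c| + |f' c - f' s| := by
        linarith [abs_sub_abs_le_abs_sub (f' s) (f' c), abs_sub_comm (f' s) (f' c)]
    _ ≤ |f' c| + M := by gcongr; nlinarith

/-- On `[-R, R]`, the function `w` is nonnegative, with derivatives `w₁` and `w₂`, and solves
`w'' = s w + 2 w³ - β` up to an error of size `δ (1 + w)`. -/
structure IsApproxPainleve (β δ R : ℝ) (w w₁ w₂ : ℝ → ℝ) : Prop where
  nonneg : ∀ s, |s| ≤ R → 0 ≤ w s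
  hasDerivAt : ∀ s, |s| ≤ R → HasDerivAt w (w₁ s) s
  hasDerivAt_deriv : ∀ s, |s| ≤ R → HasDerivAt w₁ (w₂ s) s
  abs_sub_le : ∀ s, |s| ≤ R → |w₂ s - (s * w s + 2 * w s ^ 3 - β)| ≤ δ * (1 + w s)

namespace IsApproxPainleve

variable {β R s : ℝ} {w w₁ w₂ : ℝ → ℝ}

theorem le_of_abs_le (h : IsApproxPainleve β 1 (R + 1) w w₁ w₂) (hs : |s| ≤ R) :
    w s ≤ R + |β| + 5 := by
  have hR : 0 ≤ R := (abs_nonneg s).trans hs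
  have hmem : ∀ t ∈ Set.Icc (s - 1) (s + 1), |t| ≤ R + 1 := fun t ht => by
    rw [abs_le] at *
    constructor <;> linarith [ht.1, ht.2]
  have hA : 1 ≤ R + |β| + 3 := by linarith [abs_nonneg β]
  have hA₂ : R + |β| + 3 ≤ (R + |β| + 3) ^ 2 := le_self_pow₀ hA two_ne_zero
  have : (R + |β| + 3) ^ 2 ≤ (R + |β| + 3) ^ 3 := pow_le_pow_right₀ hA (by norm_num)
  have hle := le_of_second_deriv_ge_cubic (T := R + 2) (b := |β| + 1) (A := R + |β| + 3)
    (by linarith) (by nlinarith [abs_nonneg β]) (by linarith [abs_nonneg β])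
    (fun t ht => h.hasDerivAt t (hmem t ht)) (fun t ht => h.hasDerivAt_deriv t (hmem t ht))
    (fun t ht => by
      have hwt := h.nonneg t (hmem t ht)
      have herr := (abs_le.1 (h.abs_sub_le t (hmem t ht))).1
      nlinarith [mul_nonneg (neg_le_iff_add_nonneg'.1 (abs_le.1 (hmem t ht)).1) hwt,
        le_abs_self β])
  linarith

theorem abs_second_deriv_le (h : IsApproxPainleve β 1 R w w₁ w₂) {B : ℝ} (hs : |s| ≤ R)
    (hB : w s ≤ B) : |w₂ s| ≤ R * B + 2 * B ^ 3 + |β| + (1 + B) := by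
  have hw := h.nonneg s hs
  have hexact : |s * w s + 2 * w s ^ 3 - β| ≤ R * B + 2 * B ^ 3 + |β| := calc
    _ ≤ |s * w s| + |2 * w s ^ 3| + |β| :=
      (abs_sub _ _).trans (by gcongr; exact abs_add_le _ _)
    _ = |s| * w s + 2 * w s ^ 3 + |β| := by
      rw [abs_mul, abs_of_nonneg hw, abs_of_nonneg (by positivity : 0 ≤ 2 * w s ^ 3)]
    _ ≤ R * B + 2 * B ^ 3 + |β| := by gcongr; exact (abs_nonneg s).trans hs
  have herr := h.abs_sub_le s hs
  have hsplit := abs_sub_abs_le_abs_sub (w₂ s) (s * w s + 2 * w s ^ 3 - β)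
  linarith

end IsApproxPainleve

theorem exists_bound_of_isApproxPainleve (β R : ℝ) :
    ∃ M : NNReal, ∀ w w₁ w₂ : ℝ → ℝ, IsApproxPainleve β 1 (R + 2) w w₁ w₂ →
      ∀ s, |s| ≤ R → |w s| ≤ M ∧ |w₁ s| ≤ M ∧ |w₂ s| ≤ M := by
  rcases lt_or_ge R 0 with hR | hR
  · exact ⟨0, fun w w₁ w₂ _ s hs => absurd ((abs_nonneg s).trans hs) hR.not_ge⟩
  set B := (R + 1) + |β| + 5
  set M₂ := (R + 2) * B + 2 * B ^ 3 + |β| + (1 + B)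
  have hB₀ : 0 ≤ B := by positivity
  have hM₂₀ : 0 ≤ M₂ := by positivity
  refine ⟨(B + M₂).toNNReal, fun w w₁ w₂ h s hs => ?_⟩
  rw [Real.coe_toNNReal _ (by positivity)]
  have hw : ∀ t, |t| ≤ R + 1 → 0 ≤ w t ∧ w t ≤ B ∧ |w₂ t| ≤ M₂ := fun t ht => by
    have ht₂ : |t| ≤ R + 2 := by linarith
    have hle : w t ≤ B := IsApproxPainleve.le_of_abs_le
      (by rwa [show R + 1 + 1 = R + 2 by ring]) ht
    exact ⟨h.nonneg t ht₂, hle, h.abs_second_deriv_le ht₂ hle⟩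
  have hmem : ∀ t ∈ Set.Icc s (s + 1), |t| ≤ R + 1 := fun t ht => by
    rw [abs_le] at *
    constructor <;> linarith [ht.1, ht.2]
  obtain ⟨hw₀, hwB, hw₂⟩ := hw s (by linarith)
  obtain ⟨hw₀', hwB', -⟩ := hw (s + 1) (hmem _ ⟨by linarith, le_rfl⟩)
  have hderiv := abs_deriv_le_of_abs_second_deriv_le
    (fun t ht => h.hasDerivAt t (by linarith [hmem t ht]))
    (fun t ht => h.hasDerivAt_deriv t (by linarith [hmem t ht]))
    (fun t ht => (hw t (hmem t ht)).2.2)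
  have hinc : |w (s + 1) - w s| ≤ B := abs_le.2 ⟨by linarith, by linarith⟩
  exact ⟨by rw [abs_of_nonneg hw₀]; linarith, by linarith, by linarith⟩

/-- A family of nonnegative functions which, on every bounded interval, solve
`y'' = s y + 2 y³ - β` up to an error that is eventually small. -/
def ApproxPainleveODE {ι : Type*} (F : Filter ι) (β : ℝ) (w w₁ w₂ : ι → ℝ → ℝ) : Prop :=
  ∀ R δ : ℝ, 0 < δ → ∀ᶠ i in F, IsApproxPainleve β δ R (w i) (w₁ i) (w₂ i)

namespace ApproxPainleveODE

variable {ι : Type*} {F : Filter ι} {β : ℝ} {w w₁ w₂ : ι → ℝ → ℝ}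

theorem mono (h : ApproxPainleveODE F β w w₁ w₂) {G : Filter ι} (hG : G ≤ F) :
    ApproxPainleveODE G β w w₁ w₂ := fun R δ hδ => hG (h R δ hδ)

theorem exists_bound (h : ApproxPainleveODE F β w w₁ w₂) (R : ℝ) :
    ∃ M : NNReal, ∀ᶠ i in F, ∀ s, |s| ≤ R → |w i s| ≤ M ∧ |w₁ i s| ≤ M ∧ |w₂ i s| ≤ M :=
  (exists_bound_of_isApproxPainleve β R).imp fun _ hM =>
    (h (R + 2) 1 one_pos).mono fun _ hi => hM _ _ _ hi

theorem tendsto_prod_nhds (h : ApproxPainleveODE F β w w₁ w₂) {x a b : ℝ}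
    (hw : Tendsto (fun i => w i x) F (𝓝 a)) (hw₁ : Tendsto (fun i => w₁ i x) F (𝓝 b)) :
    Tendsto (fun p : ι × ℝ => w p.1 p.2) (F ×ˢ 𝓝 x) (𝓝 a) ∧
      Tendsto (fun p : ι × ℝ => w₁ p.1 p.2) (F ×ˢ 𝓝 x) (𝓝 b) := by
  obtain ⟨M, hM⟩ := h.exists_bound (|x| + 1)
  have hmem : ∀ t ∈ Metric.closedBall x 1, |t| ≤ |x| + 1 := fun t ht => by
    rw [Metric.mem_closedBall, Real.dist_eq] at ht
    linarith [abs_sub_abs_le_abs_sub t x]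
  have hball : Metric.closedBall x 1 ∈ 𝓝 x := Metric.closedBall_mem_nhds x one_pos
  refine ⟨tendsto_prod_nhds_of_lipschitzOnWith (K := M) hball ?_ hw,
    tendsto_prod_nhds_of_lipschitzOnWith (K := M) hball ?_ hw₁⟩
  all_goals filter_upwards [hM, h (|x| + 1) 1 one_pos] with i hi hapx
  · exact (convex_closedBall x 1).lipschitzOnWith_of_nnnorm_hasDerivWithin_le
      (fun t ht => (hapx.hasDerivAt t (hmem t ht)).hasDerivWithinAt)
      (fun t ht => (hi t (hmem t ht)).2.1)
  · exact (convex_closedBall x 1).lipschitzOnWith_of_nnnorm_hasDerivWithin_le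
      (fun t ht => (hapx.hasDerivAt_deriv t (hmem t ht)).hasDerivWithinAt)
      (fun t ht => (hi t (hmem t ht)).2.2)

theorem tendsto_error (h : ApproxPainleveODE F β w w₁ w₂) (x : ℝ) :
    Tendsto (fun p : ι × ℝ => w₂ p.1 p.2 - (p.2 * w p.1 p.2 + 2 * w p.1 p.2 ^ 3 - β))
      (F ×ˢ 𝓝 x) (𝓝 0) := by
  obtain ⟨M, hM⟩ := h.exists_bound (|x| + 1)
  have hnear : ∀ᶠ t in 𝓝 x, |t| ≤ |x| + 1 :=
    (continuous_abs.tendsto x).eventually_le_const (lt_add_one |x|)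
  refine Metric.tendsto_nhds.2 fun ε hε => ?_
  have hδ : 0 < ε / (2 * (1 + M)) := by positivity
  filter_upwards [(hM.and (h (|x| + 1) _ hδ)).prod_mk hnear] with p hp
  obtain ⟨⟨hi, hapx⟩, ht⟩ := hp
  rw [Real.dist_0_eq_abs]
  calc _ ≤ ε / (2 * (1 + M)) * (1 + w p.1 p.2) := hapx.abs_sub_le _ ht
    _ ≤ ε / (2 * (1 + M)) * (1 + M) := by
      gcongr
      exact (le_abs_self _).trans (hi _ ht).1
    _ = ε / 2 := by field_simp
    _ < ε := half_lt_self hε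

theorem painleveODE_of_tendsto [F.NeBot] (h : ApproxPainleveODE F β w w₁ w₂) {W W₁ : ℝ → ℝ}
    (hw : ∀ s, Tendsto (fun i => w i s) F (𝓝 (W s)))
    (hw₁ : ∀ s, Tendsto (fun i => w₁ i s) F (𝓝 (W₁ s))) : PainleveODE β W W₁ := by
  have hcont := fun s => h.tendsto_prod_nhds (hw s) (hw₁ s)
  have hw₂ : ∀ s, Tendsto (fun p : ι × ℝ => w₂ p.1 p.2) (F ×ˢ 𝓝 s)
      (𝓝 (s * W s + 2 * W s ^ 3 - β)) := fun s => by
    have hsum := (h.tendsto_error s).add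
      (((tendsto_snd.mul (hcont s).1).add (((hcont s).1.pow 3).const_mul 2)).sub_const β)
    simpa only [sub_add_cancel, zero_add] using hsum
  have hball : ∀ s, s ∈ Metric.ball (0 : ℝ) (|s| + 1) := fun s => by simp
  refine ⟨fun s => ?_, fun s => ?_⟩
  · refine hasDerivAt_of_tendstoLocallyUniformlyOn Metric.isOpen_ball
      (tendstoLocallyUniformly_of_forall_tendsto_prod_nhds
        fun s => (hcont s).2).tendstoLocallyUniformlyOn ?_ (fun t _ => hw t) (hball s)
    filter_upwards [h (|s| + 1) 1 one_pos] with i hi t ht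
    exact hi.hasDerivAt t (by simpa using (mem_ball_zero_iff.1 ht).le)
  · refine hasDerivAt_of_tendstoLocallyUniformlyOn Metric.isOpen_ball
      (tendstoLocallyUniformly_of_forall_tendsto_prod_nhds hw₂).tendstoLocallyUniformlyOn
      ?_ (fun t _ => hw₁ t) (hball s)
    filter_upwards [h (|s| + 1) 1 one_pos] with i hi t ht
    exact hi.hasDerivAt_deriv t (by simpa using (mem_ball_zero_iff.1 ht).le)

theorem exists_limit {U : Ultrafilter ι} (h : ApproxPainleveODE (U : Filter ι) β w w₁ w₂) :
    ∃ W W₁ : ℝ → ℝ, PainleveODE β W W₁ ∧ (∀ s, 0 ≤ W s) ∧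
      ∀ s, Tendsto (fun i => w i s) U (𝓝 (W s)) ∧ Tendsto (fun i => w₁ i s) U (𝓝 (W₁ s)) := by
  have hlim : ∀ s, ∃ a b, Tendsto (fun i => w i s) U (𝓝 a) ∧
      Tendsto (fun i => w₁ i s) U (𝓝 b) := fun s => by
    obtain ⟨M, hM⟩ := h.exists_bound |s|
    obtain ⟨a, ha⟩ := exists_tendsto_of_eventually_abs_le (hM.mono fun i hi => (hi s le_rfl).1)
    obtain ⟨b, hb⟩ := exists_tendsto_of_eventually_abs_le (hM.mono fun i hi => (hi s le_rfl).2.1)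
    exact ⟨a, b, ha, hb⟩
  choose W W₁ hW hW₁ using hlim
  refine ⟨W, W₁, h.painleveODE_of_tendsto hW hW₁, fun s => ge_of_tendsto (hW s) ?_,
    fun s => ⟨hW s, hW₁ s⟩⟩
  filter_upwards [h |s| 1 one_pos] with i hi using hi.nonneg s le_rfl

theorem tendstoLocallyUniformly (h : ApproxPainleveODE F β w w₁ w₂) (hβ : 0 < β) {y z : ℝ → ℝ}
    (hy : PainleveODE β y z) (hy₀ : ∀ s, 0 ≤ y s) :
    TendstoLocallyUniformly w y F ∧ TendstoLocallyUniformly w₁ z F := by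
  have hlim : ∀ U : Ultrafilter ι, (U : Filter ι) ≤ F → ∀ s,
      Tendsto (fun i => w i s) U (𝓝 (y s)) ∧ Tendsto (fun i => w₁ i s) U (𝓝 (z s)) := by
    intro U hU
    obtain ⟨W, W₁, hW, hW₀, hlim⟩ := (h.mono hU).exists_limit
    obtain rfl : W = y := hy.eq_of_nonneg hβ hy₀ hW hW₀
    obtain rfl : W₁ = z := hW.deriv_eq.symm.trans hy.deriv_eq
    exact hlim
  have hcont := fun s => h.tendsto_prod_nhds
    ((tendsto_iff_ultrafilter _ F _).2 fun U hU => (hlim U hU s).1)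
    ((tendsto_iff_ultrafilter _ F _).2 fun U hU => (hlim U hU s).2)
  exact ⟨tendstoLocallyUniformly_of_forall_tendsto_prod_nhds fun s => (hcont s).1,
    tendstoLocallyUniformly_of_forall_tendsto_prod_nhds fun s => (hcont s).2⟩

end ApproxPainleveODE

section Shooting

variable {a b : ℝ}

theorem exists_flow_of_lipschitzWith_of_norm_le {E : Type*} [NormedAddCommGroup E]
    [NormedSpace ℝ E] [CompleteSpace E] {f : ℝ → E → E} {K L : NNReal} (hab : a ≤ b)
    (hlip : ∀ t ∈ Set.Icc a b, LipschitzWith K (f t))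
    (hcont : ∀ x, ContinuousOn (fun t => f t x) (Set.Icc a b))
    (hL : ∀ t ∈ Set.Icc a b, ∀ x, ‖f t x‖ ≤ L) (r : NNReal) :
    ∃ φ : E → ℝ → E, ContinuousOn (fun x => φ x b) (Metric.closedBall 0 r) ∧
      ∀ x ∈ Metric.closedBall (0 : E) r, φ x a = x ∧
        ∀ t ∈ Set.Icc a b, HasDerivWithinAt (φ x) (f t (φ x t)) (Set.Icc a b) t := by
  have hPL : IsPicardLindelof f (tmin := a) (tmax := b) ⟨a, Set.left_mem_Icc.2 hab⟩ 0
      (L * (b - a).toNNReal + r) r L K :=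
    ⟨fun t ht => (hlip t ht).lipschitzOnWith, fun x _ => hcont x, fun t ht x _ => hL t ht x, by
      simp [Real.coe_toNNReal _ (sub_nonneg.2 hab), hab]⟩
  obtain ⟨φ, hφ, K', hK'⟩ := hPL.exists_forall_mem_closedBall_eq_hasDerivWithinAt_lipschitzOnWith
  exact ⟨φ, (hK' b (Set.right_mem_Icc.2 hab)).continuousOn, hφ⟩

theorem abs_sub_le_of_abs_deriv_le {f f' : ℝ → ℝ} {C : ℝ} (hab : a ≤ b)
    (hf : ∀ t ∈ Set.Icc a b, HasDerivWithinAt f (f' t) (Set.Icc a b) t)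
    (hC : ∀ t ∈ Set.Icc a b, |f' t| ≤ C) {t : ℝ} (ht : t ∈ Set.Icc a b) :
    |f t - f a| ≤ C * (b - a) := by
  have ha := Set.left_mem_Icc.2 hab
  refine ((convex_Icc a b).norm_image_sub_le_of_norm_hasDerivWithin_le hf hC ha ht).trans ?_
  have hC₀ : 0 ≤ C := (abs_nonneg _).trans (hC a ha)
  rw [Real.norm_eq_abs, abs_of_nonneg (sub_nonneg.2 ht.1)]
  gcongr
  exact ht.2

variable {h : ℝ → ℝ → ℝ} {G Q : ℝ} {K : NNReal}

theorem exists_secondOrder_flow (hab : a ≤ b)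
    (hlip : ∀ t ∈ Set.Icc a b, LipschitzWith K (h t))
    (hcont : ∀ x, ContinuousOn (fun t => h t x) (Set.Icc a b))
    (hG : ∀ t ∈ Set.Icc a b, ∀ x, |h t x| ≤ G) (hQ : 0 ≤ Q) :
    ∃ Y Z : ℝ → ℝ → ℝ, ContinuousOn (fun q => Y q b) (Set.Icc (-Q) Q) ∧
      ∀ q ∈ Set.Icc (-Q) Q, Y q a = 0 ∧ Z q a = q ∧ ∀ t ∈ Set.Icc a b,
        HasDerivWithinAt (Y q) (Z q t) (Set.Icc a b) t ∧
        HasDerivWithinAt (Z q) (h t (Y q t)) (Set.Icc a b) t := by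
  have : 0 ≤ b - a := sub_nonneg.2 hab
  have hG₀ : 0 ≤ G := (abs_nonneg _).trans (hG a (Set.left_mem_Icc.2 hab) 0)
  set M := Q + G * (b - a)
  have hM₀ : 0 ≤ M := by positivity
  -- Truncating the first component at `M` makes the field bounded; a slope in `[-Q, Q]` never
  -- leaves `[-M, M]`, so the truncation is not felt.
  obtain ⟨φ, hφb, hφ⟩ := exists_flow_of_lipschitzWith_of_norm_le
    (f := fun t (p : ℝ × ℝ) => (max (-M) (min M p.2), h t p.1))
    (L := (max M G).toNNReal) hab
    (fun t ht => ((LipschitzWith.prod_snd.const_min M).const_max (-M)).prodMk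
      ((hlip t ht).comp LipschitzWith.prod_fst))
    (fun p => continuousOn_const.prodMk (hcont p.1))
    (fun t ht p => by
      rw [Real.coe_toNNReal _ (le_max_of_le_left hM₀), Prod.norm_def]
      exact max_le_max (abs_le.2 ⟨le_max_left _ _, max_le (by linarith) (min_le_left _ _)⟩)
        (hG t ht _)) Q.toNNReal
  have hmem : ∀ q ∈ Set.Icc (-Q) Q,
      ((0 : ℝ), q) ∈ Metric.closedBall (0 : ℝ × ℝ) Q.toNNReal := fun q hq => by
    simpa [Prod.norm_def, abs_le, hQ] using hq
  refine ⟨fun q t => (φ (0, q) t).1, fun q t => (φ (0, q) t).2,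
    continuous_fst.comp_continuousOn (hφb.comp (by fun_prop) hmem), fun q hq => ?_⟩
  obtain ⟨hinit, hderiv⟩ := hφ _ (hmem q hq)
  have hfst : ∀ t ∈ Set.Icc a b, HasDerivWithinAt (fun t => (φ (0, q) t).1)
      (max (-M) (min M (φ (0, q) t).2)) (Set.Icc a b) t := fun t ht => (hderiv t ht).fst
  refine ⟨congrArg Prod.fst hinit, congrArg Prod.snd hinit, fun t ht =>
    ⟨(hfst t ht).congr_deriv ?_, (hderiv t ht).snd⟩⟩
  have hslope := abs_sub_le_of_abs_deriv_le hab (fun t ht => (hderiv t ht).snd)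
    (fun t ht => hG t ht _) ht
  rw [hinit, abs_le] at hslope
  have hle : (φ (0, q) t).2 ≤ M := by linarith [hq.2]
  have hge : -M ≤ (φ (0, q) t).2 := by linarith [hq.1]
  rw [min_eq_right hle, max_eq_right hge]

theorem abs_endpoint_sub_slope_mul_le {y z : ℝ → ℝ} (hab : a ≤ b)
    (hy : ∀ t ∈ Set.Icc a b, HasDerivWithinAt y (z t) (Set.Icc a b) t)
    {z' : ℝ → ℝ} (hz : ∀ t ∈ Set.Icc a b, HasDerivWithinAt z (z' t) (Set.Icc a b) t)
    (hG : ∀ t ∈ Set.Icc a b, |z' t| ≤ G) :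
    |y b - (y a + z a * (b - a))| ≤ G * (b - a) * (b - a) := by
  have hlin := abs_sub_le_of_abs_deriv_le (f := fun t => y t - z a * t) (f' := fun t => z t - z a)
    hab (fun t ht => ((hy t ht).sub ((hasDerivWithinAt_id t _).const_mul (z a))).congr_deriv
      (by simp)) (fun t ht => abs_sub_le_of_abs_deriv_le hab hz hG ht) (Set.right_mem_Icc.2 hab)
  rwa [show y b - (y a + z a * (b - a)) = y b - z a * b - (y a - z a * a) by ring]

theorem exists_dirichlet_solution_of_bounded (hab : a ≤ b)
    (hlip : ∀ t ∈ Set.Icc a b, LipschitzWith K (h t))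
    (hcont : ∀ x, ContinuousOn (fun t => h t x) (Set.Icc a b))
    (hG : ∀ t ∈ Set.Icc a b, ∀ x, |h t x| ≤ G) :
    ∃ y z : ℝ → ℝ, y a = 0 ∧ y b = 0 ∧ ∀ t ∈ Set.Icc a b,
      HasDerivWithinAt y (z t) (Set.Icc a b) t ∧
      HasDerivWithinAt z (h t (y t)) (Set.Icc a b) t := by
  have : 0 ≤ b - a := sub_nonneg.2 hab
  have hG₀ : 0 ≤ G := (abs_nonneg _).trans (hG a (Set.left_mem_Icc.2 hab) 0)
  set Q := G * (b - a)
  have hQ₀ : 0 ≤ Q := by positivity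
  obtain ⟨Y, Z, hYb, hYZ⟩ := exists_secondOrder_flow hab hlip hcont hG hQ₀
  have hend : ∀ q ∈ Set.Icc (-Q) Q, |Y q b - q * (b - a)| ≤ Q * (b - a) := fun q hq => by
    obtain ⟨hYa, hZa, hsol⟩ := hYZ q hq
    have hle := abs_endpoint_sub_slope_mul_le hab (fun t ht => (hsol t ht).1)
      (fun t ht => (hsol t ht).2) (fun t ht => hG t ht _)
    rwa [hYa, hZa, zero_add] at hle
  have hneg : Y (-Q) b ≤ 0 := by
    linarith [(abs_le.1 (hend (-Q) ⟨le_rfl, by linarith⟩)).2]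
  have hpos : 0 ≤ Y Q b := by
    linarith [(abs_le.1 (hend Q ⟨by linarith, le_rfl⟩)).1]
  obtain ⟨q, hq, hqb⟩ := intermediate_value_Icc (by linarith : -Q ≤ Q) hYb ⟨hneg, hpos⟩
  exact ⟨Y q, Z q, (hYZ q hq).1, hqb, (hYZ q hq).2.2⟩

/-- The constants `0` and `p` are a strict sub- and supersolution of `y'' = h(t, y)`; a solution of
the equation with `h(t, ·)` frozen outside `[0, p]` cannot leave `[0, p]`. -/
theorem exists_dirichlet_solution_mem_Icc {p : ℝ} (hab : a ≤ b) (hp : 0 ≤ p)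
    (hlip : ∀ t ∈ Set.Icc a b, LipschitzOnWith K (h t) (Set.Icc 0 p))
    (hcont : ∀ x ∈ Set.Icc 0 p, ContinuousOn (fun t => h t x) (Set.Icc a b))
    (hG : ∀ t ∈ Set.Icc a b, ∀ x ∈ Set.Icc 0 p, |h t x| ≤ G)
    (hsub : ∀ t ∈ Set.Ioo a b, h t 0 < 0) (hsuper : ∀ t ∈ Set.Ioo a b, 0 < h t p) :
    ∃ y z : ℝ → ℝ, ∀ t ∈ Set.Ioo a b, y t ∈ Set.Icc 0 p ∧ HasDerivAt y (z t) t ∧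
      HasDerivAt z (h t (y t)) t := by
  set c : ℝ → ℝ := fun x => Set.projIcc 0 p hp x with hc
  have hcmem : ∀ x, c x ∈ Set.Icc 0 p := fun x => (Set.projIcc 0 p hp x).2
  obtain ⟨y, z, hya, hyb, hyz⟩ := exists_dirichlet_solution_of_bounded
    (h := fun t x => h t (c x)) hab
    (fun t ht => mul_one K ▸ (hlip t ht).to_restrict.comp (LipschitzWith.projIcc hp))
    (fun x => hcont _ (hcmem x)) (fun t ht x => hG t ht _ (hcmem x))
  have hyc : ContinuousOn y (Set.Icc a b) := fun t ht => (hyz t ht).1.continuousWithinAt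
  have hy : ∀ t ∈ Set.Ioo a b, HasDerivAt y (z t) t := fun t ht =>
    (hyz t (Set.Ioo_subset_Icc_self ht)).1.hasDerivAt (Icc_mem_nhds ht.1 ht.2)
  have hz : ∀ t ∈ Set.Ioo a b, HasDerivAt z (h t (c (y t))) t := fun t ht =>
    (hyz t (Set.Ioo_subset_Icc_self ht)).2.hasDerivAt (Icc_mem_nhds ht.1 ht.2)
  have hmem : ∀ t ∈ Set.Ioo a b, y t ∈ Set.Icc 0 p := by
    refine fun t ht => ⟨?_, ?_⟩ <;> by_contra! hlt
    · obtain ⟨x, hx, hle, -, hmax⟩ := exists_critical_isMaxOn_of_pos (u := fun t => -y t) hyc.neg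
        (fun s hs => (hy s hs).neg) (fun s hs => (hz s hs).neg) (by simp [hya]) (by simp [hyb])
        (Set.Ioo_subset_Icc_self ht) (by simpa using hlt)
      have hcx : c (y x) = 0 := by simp [hc, Set.projIcc_of_le_left hp (by linarith : y x ≤ 0)]
      rw [hcx] at hmax
      linarith [hsub x hx]
    · obtain ⟨x, hx, hle, -, hmax⟩ := exists_critical_isMaxOn_of_pos (u := fun t => y t - p)
        (hyc.sub continuousOn_const) (fun s hs => (hy s hs).sub_const p) hz (by simp [hya, hp])
        (by simp [hyb, hp]) (Set.Ioo_subset_Icc_self ht) (by simpa using hlt)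
      have hcx : c (y x) = p := by simp [hc, Set.projIcc_of_right_le hp (by linarith : p ≤ y x)]
      rw [hcx] at hmax
      linarith [hsuper x hx]
  refine ⟨y, z, fun t ht => ⟨hmem t ht, hy t ht, (hz t ht).congr_deriv ?_⟩⟩
  simp [hc, Set.projIcc_of_mem hp (hmem t ht)]

end Shooting

theorem lipschitzOnWith_painleve_rhs (β : ℝ) {N p t : ℝ} (ht : |t| ≤ N) :
    LipschitzOnWith (N + 6 * p ^ 2).toNNReal (fun x => t * x + 2 * x ^ 3 - β) (Set.Icc 0 p) := by
  have hN : 0 ≤ N := (abs_nonneg t).trans ht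
  refine (convex_Icc 0 p).lipschitzOnWith_of_nnnorm_hasDerivWithin_le
    (f' := fun x => t + 6 * x ^ 2) (fun x _ => ?_) fun x hx => ?_
  · exact ((((hasDerivAt_id x).const_mul t).add (((hasDerivAt_id x).pow 3).const_mul 2)).sub_const
      β).hasDerivWithinAt.congr_deriv (by simp; ring)
  · rw [← NNReal.coe_le_coe, coe_nnnorm, Real.coe_toNNReal _ (by positivity)]
    calc |t + 6 * x ^ 2| ≤ |t| + |6 * x ^ 2| := abs_add_le _ _
      _ = |t| + 6 * x ^ 2 := by rw [abs_of_nonneg (by positivity : 0 ≤ 6 * x ^ 2)]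
      _ ≤ N + 6 * p ^ 2 := by gcongr <;> [exact hx.1; exact hx.2]

theorem exists_painleve_solution_Ioo {β N : ℝ} (hβ : 0 < β) (hN : 0 < N) :
    ∃ y z : ℝ → ℝ, ∀ s ∈ Set.Ioo (-N) N, 0 ≤ y s ∧ HasDerivAt y (z s) s ∧
      HasDerivAt z (s * y s + 2 * y s ^ 3 - β) s := by
  set p := 1 + N + β
  have hp₀ : 0 < p := by positivity
  obtain ⟨y, z, hyz⟩ := exists_dirichlet_solution_mem_Icc
    (h := fun s x => s * x + 2 * x ^ 3 - β) (G := N * p + 2 * p ^ 3 + β)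
    (by linarith : -N ≤ N) hp₀.le (fun t ht => lipschitzOnWith_painleve_rhs β (abs_le.2 ht))
    (fun x _ => by fun_prop)
    (fun t ht x hx => by
      have hx₃ : x ^ 3 ≤ p ^ 3 := pow_le_pow_left₀ hx.1 hx.2 3
      have htx : |t * x| ≤ N * p := by
        rw [abs_mul, abs_of_nonneg hx.1]
        exact mul_le_mul (abs_le.2 ht) hx.2 hx.1 hN.le
      rw [abs_le] at htx ⊢
      constructor <;> linarith [pow_nonneg hx.1 3])
    (fun t _ => by simpa using hβ)
    (fun t ht => by
      nlinarith [mul_pos hp₀ (by linarith [ht.1] : 0 < t + N), mul_pos hp₀ hN, mul_pos hp₀ hβ,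
        mul_pos hp₀ hp₀, mul_pos (mul_pos hp₀ hp₀) hN, mul_pos (mul_pos hp₀ hp₀) hβ])
  exact ⟨y, z, fun s hs => ⟨(hyz s hs).1.1, (hyz s hs).2⟩⟩

theorem exists_nonneg_painleveODE {β : ℝ} (hβ : 0 < β) :
    ∃ y z : ℝ → ℝ, PainleveODE β y z ∧ ∀ s, 0 ≤ y s := by
  choose Y Z hYZ using fun n : ℕ => exists_painleve_solution_Ioo hβ (Nat.cast_add_one_pos n)
  have happrox : ApproxPainleveODE atTop β Y Z fun n s => s * Y n s + 2 * Y n s ^ 3 - β := by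
    intro R δ hδ
    filter_upwards [tendsto_natCast_atTop_atTop.eventually_gt_atTop R] with n hn
    have hsol := fun s (hs : |s| ≤ R) => hYZ n s (abs_lt.1 (by linarith))
    refine ⟨fun s hs => (hsol s hs).1, fun s hs => (hsol s hs).2.1, fun s hs => (hsol s hs).2.2,
      fun s hs => ?_⟩
    rw [sub_self, abs_zero]
    exact mul_nonneg hδ.le (add_nonneg zero_le_one (hsol s hs).1)
  obtain ⟨y, z, hyz, hy, -⟩ := (happrox.mono Nat.hyperfilter_le_atTop).exists_limit
  exact ⟨y, z, hyz, hy⟩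

/-- `g` is a weak derivative of `u`. The integrals are only meaningful for locally integrable `u`
and `g`, which is assumed separately where it matters. -/
def HasWeakDeriv (u g : ℝ → ℝ) : Prop :=
  ∀ φ : ℝ → ℝ, ContDiff ℝ ∞ φ → HasCompactSupport φ → ∫ x, u x * deriv φ x = -∫ x, g x * φ x

section WeakDerivative

variable {φ u g k : ℝ → ℝ}

theorem exists_tsupport_subset_Ioo (hφ : HasCompactSupport φ) :
    ∃ R, 0 < R ∧ tsupport φ ⊆ Set.Ioo (-R) R := by
  obtain ⟨R, hR, hsub⟩ := hφ.isCompact.isBounded.subset_ball_lt 0 0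
  rw [Real.ball_eq_Ioo, zero_sub, zero_add] at hsub
  exact ⟨R, hR, hsub⟩

theorem hasDerivAt_integral_of_continuous (hg : Continuous g) (a x : ℝ) :
    HasDerivAt (fun x => ∫ t in a..x, g t) (g x) x :=
  intervalIntegral.integral_hasDerivAt_right (hg.intervalIntegrable _ _)
    (hg.stronglyMeasurableAtFilter _ _) hg.continuousAt

theorem exists_hasCompactSupport_deriv_eq (hφ : ContDiff ℝ ∞ φ) (hφc : HasCompactSupport φ)
    (hint : ∫ x, φ x = 0) : ∃ Φ, ContDiff ℝ ∞ Φ ∧ HasCompactSupport Φ ∧ deriv Φ = φ := by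
  obtain ⟨R, -, hR⟩ := exists_tsupport_subset_Ioo hφc
  have hzero : ∀ t ∉ Set.Ioo (-R) R, φ t = 0 := fun t ht =>
    image_eq_zero_of_notMem_tsupport fun h => ht (hR h)
  have hφi : Integrable φ := hφ.continuous.integrable_of_hasCompactSupport hφc
  have hΦ : ∀ x, HasDerivAt (fun x => ∫ t in Set.Iic x, φ t) (φ x) x := fun x => by
    refine ((hasDerivAt_integral_of_continuous hφ.continuous 0 x).add_const
      (∫ t in Set.Iic 0, φ t)).congr_of_eventuallyEq (Eventually.of_forall fun y => ?_)
    exact sub_eq_iff_eq_add.1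
      (intervalIntegral.integral_Iic_sub_Iic hφi.integrableOn hφi.integrableOn)
  have hderiv : deriv (fun x => ∫ t in Set.Iic x, φ t) = φ := funext fun x => (hΦ x).deriv
  refine ⟨_, contDiff_infty_iff_deriv.2
      ⟨fun x => (hΦ x).differentiableAt, by rw [hderiv]; exact hφ⟩,
    HasCompactSupport.intro (isCompact_Icc (a := -R) (b := R)) fun x hx => ?_, hderiv⟩
  rw [Set.mem_Icc, not_and_or, not_le, not_le] at hx
  rcases hx with hx | hx
  · exact setIntegral_eq_zero_of_forall_eq_zero fun t ht =>
      hzero t fun h => (h.1.trans_le ht).not_gt hx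
  · exact (setIntegral_eq_integral_of_forall_compl_eq_zero (s := Set.Iic x) fun t ht =>
      hzero t fun h => ht (h.2.trans hx).le).trans hint

/-- Subtracting a multiple of a bump function turns any test function into one of mean zero, which
is the derivative of a test function. -/
theorem exists_ae_eq_const_of_integral_mul_deriv_eq_zero (hu : LocallyIntegrable u)
    (h : ∀ φ : ℝ → ℝ, ContDiff ℝ ∞ φ → HasCompactSupport φ → ∫ x, u x * deriv φ x = 0) :
    ∃ c : ℝ, u =ᵐ[volume] fun _ => c := by
  set b : ContDiffBump (0 : ℝ) := default
  set ρ := b.normed volume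
  have hρs : ContDiff ℝ ∞ ρ := b.contDiff_normed
  have hρc : HasCompactSupport ρ := b.hasCompactSupport_normed
  refine ⟨∫ x, ρ x * u x, ae_eq_of_integral_contDiff_smul_eq hu
    (locallyIntegrable_const _) fun ψ hψs hψc => ?_⟩
  simp only [smul_eq_mul]
  rw [integral_mul_const]
  set m := ∫ x, ψ x
  have hmean : ∫ x, (ψ x - m * ρ x) = 0 := by
    rw [integral_sub (hψs.continuous.integrable_of_hasCompactSupport hψc)
      ((hρs.continuous.integrable_of_hasCompactSupport hρc).const_mul m), integral_const_mul,
      b.integral_normed, mul_one, sub_self]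
  obtain ⟨φ, hφs, hφc, hφ'⟩ := exists_hasCompactSupport_deriv_eq
    (hψs.sub (contDiff_const.mul hρs)) (hψc.sub hρc.mul_left) hmean
  have hψu : Integrable fun x => ψ x * u x :=
    hu.integrable_smul_left_of_hasCompactSupport hψs.continuous hψc
  have hρu : Integrable fun x => ρ x * u x :=
    hu.integrable_smul_left_of_hasCompactSupport hρs.continuous hρc
  have hortho : ∫ x, (ψ x * u x - m * (ρ x * u x)) = 0 := by
    rw [← h φ hφs hφc, hφ']
    exact integral_congr_ae (Eventually.of_forall fun x => by dsimp only; ring)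
  rwa [integral_sub hψu (hρu.const_mul m), integral_const_mul, sub_eq_zero] at hortho

theorem hasWeakDeriv_primitive (hg : LocallyIntegrable g) :
    HasWeakDeriv (fun x => ∫ t in (0 : ℝ)..x, g t) g := by
  intro φ hφ hφc
  obtain ⟨R, hR, hsub⟩ := exists_tsupport_subset_Ioo hφc
  have hsub' : tsupport φ ⊆ Set.Ioc (-R) R := hsub.trans Set.Ioo_subset_Ioc_self
  have hzero : ∀ x ∉ Set.Ioo (-R) R, φ x = 0 := fun x hx =>
    image_eq_zero_of_notMem_tsupport fun h => hx (hsub h)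
  have hgi : IntervalIntegrable g volume (-R) R :=
    (hg.integrableOn_isCompact isCompact_uIcc).intervalIntegrable
  rw [← intervalIntegral.integral_eq_integral_of_support_subset
      ((Function.support_mul_subset_right _ _).trans ((support_deriv_subset).trans hsub')),
    ← intervalIntegral.integral_eq_integral_of_support_subset
      ((Function.support_mul_subset_right _ _).trans ((subset_tsupport φ).trans hsub')),
    (hgi.absolutelyContinuousOnInterval_intervalIntegral
      (Set.mem_uIcc_of_le (by linarith) hR.le)).integral_mul_deriv_eq_deriv_mul
      (ContDiffOn.absolutelyContinuousOnInterval (hφ.of_le (by simp)).contDiffOn),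
    hzero R (by simp), hzero (-R) (by simp)]
  simp only [mul_zero, sub_zero, zero_sub]
  congr 1
  refine intervalIntegral.integral_congr_ae ?_
  filter_upwards [_root_.LocallyIntegrable.ae_hasDerivAt_integral hg] with x hx _
  rw [(hx 0).deriv]

namespace HasWeakDeriv

theorem exists_ae_eq_add_primitive (h : HasWeakDeriv u g) (hu : LocallyIntegrable u)
    (hg : LocallyIntegrable g) : ∃ c, u =ᵐ[volume] fun x => c + ∫ t in (0 : ℝ)..x, g t := by
  have hprim : LocallyIntegrable fun x => ∫ t in (0 : ℝ)..x, g t :=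
    (intervalIntegral.continuous_primitive
      (fun a b => (hg.integrableOn_isCompact isCompact_uIcc).intervalIntegrable)
      0).locallyIntegrable
  obtain ⟨c, hc⟩ := exists_ae_eq_const_of_integral_mul_deriv_eq_zero (hu.sub hprim)
    fun φ hφ hφc => by
      have hφ' : Continuous (deriv φ) := hφ.continuous_deriv (by simp)
      have hint : ∀ {q : ℝ → ℝ}, LocallyIntegrable q → Integrable fun x => q x * deriv φ x :=
        fun hq => by
          simpa only [smul_eq_mul] using
            hq.integrable_smul_right_of_hasCompactSupport hφ' hφc.deriv
      simp only [Pi.sub_apply, sub_mul]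
      rw [integral_sub (hint hu) (hint hprim), h φ hφ hφc, hasWeakDeriv_primitive hg φ hφ hφc,
        sub_self]
  exact ⟨c, hc.mono fun x hx => eq_add_of_sub_eq hx⟩

theorem sub_eq_integral (h : HasWeakDeriv u g) (hu : Continuous u) (hg : LocallyIntegrable g)
    (x y : ℝ) : u y - u x = ∫ t in x..y, g t := by
  have hgi : ∀ a b, IntervalIntegrable g volume a b := fun a b =>
    (hg.integrableOn_isCompact isCompact_uIcc).intervalIntegrable
  obtain ⟨c, hc⟩ := h.exists_ae_eq_add_primitive hu.locallyIntegrable hg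
  have hrep : u = fun x => c + ∫ t in (0 : ℝ)..x, g t :=
    (Continuous.ae_eq_iff_eq volume hu
      (continuous_const.add (intervalIntegral.continuous_primitive hgi 0))).1 hc
  simp only [hrep]
  rw [add_sub_add_left_eq_sub,
    intervalIntegral.integral_interval_sub_left (hgi 0 y) (hgi 0 x)]

theorem exists_hasDerivAt (h : HasWeakDeriv u g) (h' : HasWeakDeriv g k) (hu : Continuous u)
    (hg : LocallyIntegrable g) (hk : Continuous k) :
    ∃ z : ℝ → ℝ, (∀ x, HasDerivAt u (z x) x) ∧ ∀ x, HasDerivAt z (k x) x := by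
  obtain ⟨c, hc⟩ := h'.exists_ae_eq_add_primitive hg hk.locallyIntegrable
  set z : ℝ → ℝ := fun x => c + ∫ t in (0 : ℝ)..x, k t
  have hz' : ∀ x, HasDerivAt z (k x) x := fun x =>
    (hasDerivAt_integral_of_continuous hk 0 x).const_add c
  have hzc : Continuous z := continuous_iff_continuousAt.2 fun x => (hz' x).continuousAt
  have hrep : u = fun x => u 0 + ∫ t in (0 : ℝ)..x, z t := funext fun x => by
    rw [← intervalIntegral.integral_congr_ae (hc.mono fun t ht _ => ht),
      ← h.sub_eq_integral hu hg, add_sub_cancel]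
  refine ⟨z, fun x => ?_, hz'⟩
  rw [hrep]
  exact (hasDerivAt_integral_of_continuous hzc 0 x).const_add (u 0)

end HasWeakDeriv

theorem exists_mem_Icc_sq_le_integral_sq (hu : Continuous u) (hu₂ : Integrable fun x => u x ^ 2)
    (x : ℝ) : ∃ z ∈ Set.Icc x (x + 1), u z ^ 2 ≤ ∫ t, u t ^ 2 := by
  obtain ⟨z, hz, hmin⟩ := (isCompact_Icc (a := x) (b := x + 1)).exists_isMinOn
    ⟨x, by simp⟩ (hu.pow 2).continuousOn
  refine ⟨z, hz, ?_⟩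
  calc u z ^ 2 = ∫ _ in x..(x + 1), u z ^ 2 := by simp
    _ ≤ ∫ t in x..(x + 1), u t ^ 2 := intervalIntegral.integral_mono_on (by linarith)
        (by simp) ((hu.pow 2).intervalIntegrable _ _) fun t ht => hmin ht
    _ ≤ ∫ t, u t ^ 2 := by
        rw [intervalIntegral.integral_of_le (by linarith)]
        exact setIntegral_le_integral hu₂ (Eventually.of_forall fun t => sq_nonneg _)

theorem abs_integral_le_add_integral_sq (hg : Integrable fun x => g x ^ 2) {a b : ℝ}
    (hab : a ≤ b) : |∫ t in a..b, g t| ≤ (b - a) + ∫ t, g t ^ 2 := by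
  calc |∫ t in a..b, g t| ≤ ∫ t in a..b, (1 + g t ^ 2) := by
        rw [← Real.norm_eq_abs]
        refine intervalIntegral.norm_integral_le_of_norm_le hab
          (Eventually.of_forall fun t _ => ?_) (intervalIntegrable_const.add hg.intervalIntegrable)
        rw [Real.norm_eq_abs, ← sq_abs]
        nlinarith [sq_nonneg (|g t| - 1)]
    _ = (b - a) + ∫ t in a..b, g t ^ 2 := by
        rw [intervalIntegral.integral_add intervalIntegrable_const hg.intervalIntegrable]
        simp
    _ ≤ (b - a) + ∫ t, g t ^ 2 := by
        rw [intervalIntegral.integral_of_le hab]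
        exact add_le_add le_rfl
          (setIntegral_le_integral hg (Eventually.of_forall fun t => sq_nonneg _))

end WeakDerivative

namespace IsH1WithWeakDeriv

variable {u g φ μ f : ℝ → ℝ}

theorem hasWeakDeriv (h : IsH1WithWeakDeriv u g) : HasWeakDeriv u g := h.weak_deriv

theorem exists_forall_abs_le (h : IsH1WithWeakDeriv u g) (hu : Continuous u) :
    ∃ C, ∀ x, |u x| ≤ C := by
  refine ⟨(1 + ∫ t, u t ^ 2) + (1 + ∫ t, g t ^ 2), fun x => ?_⟩
  obtain ⟨z, hz, hsq⟩ := exists_mem_Icc_sq_le_integral_sq hu h.memLp.integrable_sq x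
  have huz : |u z| ≤ 1 + ∫ t, u t ^ 2 := by
    rw [← sq_abs] at hsq
    nlinarith [sq_nonneg (|u z| - 1)]
  have hdiff : |u z - u x| ≤ 1 + ∫ t, g t ^ 2 := by
    rw [h.hasWeakDeriv.sub_eq_integral hu (h.memLp_deriv.locallyIntegrable (by norm_num))]
    refine (abs_integral_le_add_integral_sq h.memLp_deriv.integrable_sq hz.1).trans ?_
    linarith [hz.2]
  calc |u x| = |u z - (u z - u x)| := by rw [sub_sub_cancel]
    _ ≤ |u z| + |u z - u x| := abs_sub _ _
    _ ≤ _ := add_le_add huz hdiff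

theorem add_const_mul (h : IsH1WithWeakDeriv u g) (hφ : ContDiff ℝ ∞ φ)
    (hφc : HasCompactSupport φ) (t : ℝ) :
    IsH1WithWeakDeriv (fun x => u x + t * φ x) (fun x => g x + t * deriv φ x) := by
  have hφ₂ : MemLp φ 2 volume := hφ.continuous.memLp_of_hasCompactSupport hφc
  have hφ₂' : MemLp (deriv φ) 2 volume :=
    (hφ.continuous_deriv (by simp)).memLp_of_hasCompactSupport hφc.deriv
  refine ⟨h.memLp.add (hφ₂.const_mul t), h.memLp_deriv.add (hφ₂'.const_mul t),
    fun ψ hψ hψc => ?_⟩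
  have hψ₂ : MemLp ψ 2 volume := hψ.continuous.memLp_of_hasCompactSupport hψc
  have hψ₂' : MemLp (deriv ψ) 2 volume :=
    (hψ.continuous_deriv (by simp)).memLp_of_hasCompactSupport hψc.deriv
  have huψ : Integrable fun x => u x * deriv ψ x := h.memLp.integrable_mul hψ₂'
  have hφψ : Integrable fun x => φ x * deriv ψ x := hφ₂.integrable_mul hψ₂'
  have hgψ : Integrable fun x => g x * ψ x := h.memLp_deriv.integrable_mul hψ₂
  have hφψ' : Integrable fun x => deriv φ x * ψ x := hφ₂'.integrable_mul hψ₂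
  have hparts : ∫ x, φ x * deriv ψ x = -∫ x, deriv φ x * ψ x :=
    integral_mul_deriv_eq_deriv_mul_of_integrable
      (fun x _ => (hφ.differentiable (by simp) x).hasDerivAt)
      (fun x _ => (hψ.differentiable (by simp) x).hasDerivAt) hφψ hφψ' (hφ₂.integrable_mul hψ₂)
  simp only [add_mul, mul_assoc]
  rw [integral_add huψ (hφψ.const_mul t), integral_add hgψ (hφψ'.const_mul t),
    integral_const_mul, integral_const_mul, h.weak_deriv ψ hψ hψc, hparts]
  ring

theorem integrable_energy (h : IsH1WithWeakDeriv u g) (hu : Continuous u)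
    (hμ : MemLp μ ⊤ volume) (hf : Integrable f) (a ε : ℝ) :
    Integrable fun x => ε / 2 * (g x) ^ 2 - 1 / (2 * ε) * μ x * (u x) ^ 2
      + 1 / (4 * ε) * (u x) ^ 4 - a * f x * u x := by
  obtain ⟨C, hC⟩ := h.exists_forall_abs_le hu
  have hu₂ := h.memLp.integrable_sq
  have hμu : Integrable fun x => μ x * u x ^ 2 := hu₂.mul_of_top_right hμ
  have hu₄ : Integrable fun x => u x ^ 2 * u x ^ 2 := by
    refine hu₂.bdd_mul (c := C ^ 2) (hu.pow 2).aestronglyMeasurable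
      (Eventually.of_forall fun x => ?_)
    rw [norm_pow]
    exact pow_le_pow_left₀ (abs_nonneg _) (hC x) 2
  have huf : Integrable fun x => u x * f x :=
    hf.bdd_mul (c := C) hu.aestronglyMeasurable (Eventually.of_forall hC)
  refine ((((h.memLp_deriv.integrable_sq.const_mul (ε / 2)).sub
    (hμu.const_mul (1 / (2 * ε)))).add (hu₄.const_mul (1 / (4 * ε)))).sub
    (huf.const_mul a)).congr (Eventually.of_forall fun x => ?_)
  simp only [Pi.add_apply, Pi.sub_apply]
  ring

end IsH1WithWeakDeriv

theorem eq_zero_of_forall_quartic_nonneg {a₁ a₂ a₃ a₄ : ℝ}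
    (h : ∀ t : ℝ, 0 ≤ t * a₁ + t ^ 2 * a₂ + t ^ 3 * a₃ + t ^ 4 * a₄) : a₁ = 0 := by
  have hmin : IsLocalMin (fun t : ℝ => t * a₁ + t ^ 2 * a₂ + t ^ 3 * a₃ + t ^ 4 * a₄) 0 :=
    Eventually.of_forall fun t => by simpa using h t
  refine hmin.hasDerivAt_eq_zero ?_
  have hderiv := ((((hasDerivAt_id (0 : ℝ)).mul_const a₁).add
    (((hasDerivAt_id (0 : ℝ)).pow 2).mul_const a₂)).add
    (((hasDerivAt_id (0 : ℝ)).pow 3).mul_const a₃)).add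
    (((hasDerivAt_id (0 : ℝ)).pow 4).mul_const a₄)
  exact hderiv.congr_deriv (by simp)

theorem integral_eq_zero_of_forall_integral_quartic_nonneg {X : Type*} [MeasurableSpace X]
    {ν : Measure X} {F₁ F₂ F₃ F₄ : X → ℝ} (h₁ : Integrable F₁ ν) (h₂ : Integrable F₂ ν)
    (h₃ : Integrable F₃ ν) (h₄ : Integrable F₄ ν)
    (h : ∀ t : ℝ, 0 ≤ ∫ x, (t * F₁ x + t ^ 2 * F₂ x + t ^ 3 * F₃ x + t ^ 4 * F₄ x) ∂ν) :
    ∫ x, F₁ x ∂ν = 0 := by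
  refine eq_zero_of_forall_quartic_nonneg (a₂ := ∫ x, F₂ x ∂ν) (a₃ := ∫ x, F₃ x ∂ν)
    (a₄ := ∫ x, F₄ x ∂ν) fun t => (h t).trans_eq ?_
  rw [integral_add (((h₁.const_mul _).fun_add (h₂.const_mul _)).fun_add (h₃.const_mul _))
      (h₄.const_mul _), integral_add ((h₁.const_mul _).fun_add (h₂.const_mul _)) (h₃.const_mul _),
    integral_add (h₁.const_mul _) (h₂.const_mul _)]
  simp only [integral_const_mul]

/-- `v` solves the Euler–Lagrange equation `ε² v'' = -μ v + v³ - ε a f` of the functional `energy`,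
written as a first-order system with `z = v'`. -/
structure EulerLagrangeODE (μ f : ℝ → ℝ) (a ε : ℝ) (v z : ℝ → ℝ) : Prop where
  hasDerivAt : ∀ x, HasDerivAt v (z x) x
  hasDerivAt_deriv :
    ∀ x, HasDerivAt z (1 / ε ^ 2 * (-μ x * v x + v x ^ 3 - ε * a * f x)) x

theorem EulerLagrangeODE.neg_comp_neg {μ f v z : ℝ → ℝ} {a ε : ℝ}
    (h : EulerLagrangeODE μ f a ε v z) (hμ : ∀ x, μ (-x) = μ x) (hf : ∀ x, f (-x) = -f x) :
    EulerLagrangeODE μ f a ε (fun x => -v (-x)) (fun x => z (-x)) := by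
  refine ⟨fun x => ((h.hasDerivAt (-x)).comp x (hasDerivAt_neg x)).neg.congr_deriv (by simp),
    fun x => ((h.hasDerivAt_deriv (-x)).comp x (hasDerivAt_neg x)).congr_deriv ?_⟩
  rw [hμ, hf]
  ring

section EulerLagrange

variable {μ f v g : ℝ → ℝ} {a ε : ℝ}

/-- The energy of `v + t φ` is a quartic polynomial in `t` whose linear coefficient must vanish. -/
theorem hasWeakDeriv_of_forall_energy_le (hμ : Continuous μ) (hμb : MemLp μ ⊤ volume)
    (hf : Continuous f) (hfi : Integrable f) (hε : ε ≠ 0) (hv : Continuous v)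
    (h : IsH1WithWeakDeriv v g)
    (hmin : ∀ u k, IsH1WithWeakDeriv u k → energy μ f a ε v g ≤ energy μ f a ε u k) :
    HasWeakDeriv g fun x => 1 / ε ^ 2 * (-μ x * v x + v x ^ 3 - ε * a * f x) := by
  intro φ hφ hφc
  have hφ₀ := hφ.continuous
  have hφ' : Continuous (deriv φ) := hφ.continuous_deriv (by simp)
  set k : ℝ → ℝ := fun x => 1 / ε ^ 2 * (-μ x * v x + v x ^ 3 - ε * a * f x) with hk
  have hkc : Continuous k := by fun_prop
  have hgφ : Integrable fun x => g x * deriv φ x :=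
    h.memLp_deriv.integrable_mul (q := 2) (hφ'.memLp_of_hasCompactSupport hφc.deriv)
  have hkφ : Integrable fun x => k x * φ x :=
    (hkc.mul hφ₀).integrable_of_hasCompactSupport hφc.mul_left
  have hquad : Integrable fun x => ε / 2 * deriv φ x * deriv φ x
      + (6 / (4 * ε) * v x ^ 2 - 1 / (2 * ε) * μ x) * φ x * φ x :=
    Continuous.integrable_of_hasCompactSupport (by fun_prop) (hφc.deriv.mul_left.add hφc.mul_left)
  have hcub : Integrable fun x => 1 / ε * v x * φ x ^ 2 * φ x :=
    Continuous.integrable_of_hasCompactSupport (by fun_prop) hφc.mul_left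
  have hquart : Integrable fun x => 1 / (4 * ε) * φ x ^ 3 * φ x :=
    Continuous.integrable_of_hasCompactSupport (by fun_prop) hφc.mul_left
  have hvar := integral_eq_zero_of_forall_integral_quartic_nonneg
    ((hgφ.add hkφ).const_mul ε) hquad hcub hquart fun t => by
      have ht := h.add_const_mul hφ hφc t
      have hle := sub_nonneg.2 (hmin _ _ ht)
      unfold energy at hle
      rw [← integral_sub (ht.integrable_energy (by fun_prop) hμb hfi a ε)
        (h.integrable_energy hv hμb hfi a ε)] at hle
      refine hle.trans_eq (integral_congr_ae (Eventually.of_forall fun x => ?_))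
      simp only [hk, Pi.add_apply]
      field_simp
      ring
  rw [integral_const_mul, integral_add' hgφ hkφ] at hvar
  exact eq_neg_of_add_eq_zero_left ((mul_eq_zero.1 hvar).resolve_left hε)

theorem IsGlobalMinimizer.exists_eulerLagrangeODE (hμ : Continuous μ) (hμb : MemLp μ ⊤ volume)
    (hf : Continuous f) (hfi : Integrable f) (hε : ε ≠ 0) (hv : IsGlobalMinimizer μ f a ε v) :
    ∃ z, EulerLagrangeODE μ f a ε v z := by
  obtain ⟨hvc, g, h, hmin⟩ := hv
  obtain ⟨z, hvz, hz⟩ := h.hasWeakDeriv.exists_hasDerivAt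
    (hasWeakDeriv_of_forall_energy_le hμ hμb hf hfi hε hvc h hmin) hvc
    (h.memLp_deriv.locallyIntegrable (by norm_num)) (by fun_prop)
  exact ⟨z, hvz, hz⟩

end EulerLagrange

section Rescaling

variable {μ f v z : ℝ → ℝ} {ξ a m ε κ h β : ℝ}

/-- The length `ε^{2/3} / m^{1/3}`, for `m = -μ'(ξ)`, on which `rescaledProfile` resolves the
transition layer at the zero `ξ` of `μ`. -/
noncomputable def layerLength (m ε : ℝ) : ℝ := ε ^ (2 / 3 : ℝ) / m ^ (1 / 3 : ℝ)

/-- The factor `2^{-1/2} (m ε)^{-1/3}`, for `m = -μ'(ξ)`, by which `rescaledProfile` multiplies the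
values of its argument. -/
noncomputable def layerFactor (m ε : ℝ) : ℝ := (2 : ℝ) ^ (-(1 / 2) : ℝ) * (m * ε) ^ (-(1 / 3) : ℝ)

theorem layerLength_pos (hm : 0 < m) (hε : 0 < ε) : 0 < layerLength m ε := by
  unfold layerLength; positivity

theorem layerFactor_pos (hm : 0 < m) (hε : 0 < ε) : 0 < layerFactor m ε := by
  unfold layerFactor; positivity

theorem mul_layerLength_pow_three (hm : 0 < m) (hε : 0 < ε) :
    m * layerLength m ε ^ 3 = ε ^ 2 := by
  rw [layerLength, div_pow, ← Real.rpow_natCast, ← Real.rpow_natCast, ← Real.rpow_mul hε.le,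
    ← Real.rpow_mul hm.le]
  norm_num
  field_simp

theorem sqrt_two_mul_mul_layerFactor (hm : 0 < m) (hε : 0 < ε) :
    √2 * ε * layerFactor m ε = layerLength m ε := by
  have hsqrt : √2 * (2 : ℝ) ^ (-(1 / 2) : ℝ) = 1 := by
    rw [Real.sqrt_eq_rpow, ← Real.rpow_add two_pos]; norm_num
  have hpow : ε * ε ^ (-(1 / 3) : ℝ) = ε ^ (2 / 3 : ℝ) := by
    nth_rewrite 1 [← Real.rpow_one ε]
    rw [← Real.rpow_add hε]; norm_num
  calc √2 * ε * layerFactor m ε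
      = (√2 * (2 : ℝ) ^ (-(1 / 2) : ℝ)) * (ε * ε ^ (-(1 / 3) : ℝ)) * (m ^ (1 / 3 : ℝ))⁻¹ := by
        rw [layerFactor, Real.mul_rpow hm.le hε.le, Real.rpow_neg hm.le]; ring
    _ = layerLength m ε := by rw [hsqrt, hpow, one_mul, ← div_eq_mul_inv, ← layerLength]

theorem tendsto_layerLength (m : ℝ) : Tendsto (layerLength m) (𝓝[>] 0) (𝓝 0) := by
  have hpow : Tendsto (fun ε : ℝ => ε ^ (2 / 3 : ℝ)) (𝓝 0) (𝓝 ((0 : ℝ) ^ (2 / 3 : ℝ))) :=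
    (Real.continuousAt_rpow_const 0 (2 / 3) (Or.inr (by norm_num))).tendsto
  rw [Real.zero_rpow (by norm_num)] at hpow
  have hquot := hpow.div_const (m ^ (1 / 3 : ℝ))
  rw [zero_div] at hquot
  exact hquot.mono_left nhdsWithin_le_nhds

theorem rescaledProfile_one (μ : ℝ → ℝ) (ξ ε : ℝ) (v : ℝ → ℝ) :
    rescaledProfile μ ξ 1 ε v = fun s =>
      layerFactor (-deriv μ ξ) ε * v (ξ + layerLength (-deriv μ ξ) ε * s) := by
  funext s
  rw [rescaledProfile, one_mul, one_mul, one_mul, layerFactor, layerLength, mul_div_left_comm,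
    mul_comm s]

theorem rescaledProfile_neg_one (μ : ℝ → ℝ) (ξ ε : ℝ) (v : ℝ → ℝ) :
    rescaledProfile μ ξ (-1) ε v = rescaledProfile μ ξ 1 ε fun x => -v (-x) := by
  funext s
  simp only [rescaledProfile, neg_mul, one_mul, mul_neg, neg_add]

namespace EulerLagrangeODE

theorem hasDerivAt_rescale (hv : EulerLagrangeODE μ f a ε v z) (κ h ξ s : ℝ) :
    HasDerivAt (fun s => κ * v (ξ + h * s)) (κ * (z (ξ + h * s) * h)) s :=
  ((hv.hasDerivAt _).comp s (((hasDerivAt_const_mul h).const_add ξ))).const_mul κ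

/-- The two relations between `h`, `κ` and `ε` normalize the coefficients of the linear and of the
cubic term to those of the second Painlevé equation. -/
theorem hasDerivAt_deriv_rescale (hv : EulerLagrangeODE μ f a ε v z) (hε : ε ≠ 0) (hm : m ≠ 0)
    (hlength : m * h ^ 3 = ε ^ 2) (hfactor : √2 * ε * κ = h) (ξ s : ℝ) :
    HasDerivAt (fun s => κ * (z (ξ + h * s) * h))
      (-(μ (ξ + h * s) / (m * h)) * (κ * v (ξ + h * s)) + 2 * (κ * v (ξ + h * s)) ^ 3
        - a * f (ξ + h * s) / (√2 * m)) s := by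
  refine ((((hv.hasDerivAt_deriv _).comp s
    ((hasDerivAt_const_mul h).const_add ξ)).mul_const h).const_mul κ).congr_deriv ?_
  have hh : h ≠ 0 := by
    rintro rfl
    exact hε (by simpa using hlength.symm)
  have hsqrt : √2 ^ 2 = 2 := Real.sq_sqrt (by norm_num)
  have hlin : h ^ 2 / ε ^ 2 = 1 / (m * h) := by rw [← hlength]; field_simp
  have hcub : h ^ 2 / ε ^ 2 = 2 * κ ^ 2 := by
    rw [← hfactor, mul_pow, mul_pow, hsqrt]; field_simp
  have hforce : κ * h ^ 2 / ε = 1 / (√2 * m) := by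
    rw [eq_div_iff (by positivity), div_mul_eq_mul_div, div_eq_iff hε, one_mul]
    refine mul_right_cancel₀ hε ?_
    linear_combination m * h ^ 2 * hfactor + hlength
  generalize v (ξ + h * s) = V, μ (ξ + h * s) = X, f (ξ + h * s) = Y
  calc κ * (1 / ε ^ 2 * (-X * V + V ^ 3 - ε * a * Y) * h * h)
      = -X * (h ^ 2 / ε ^ 2) * (κ * V) + h ^ 2 / ε ^ 2 * (κ * V ^ 3)
        - a * Y * (κ * h ^ 2 / ε) := by field_simp
    _ = -X * (1 / (m * h)) * (κ * V) + 2 * κ ^ 2 * (κ * V ^ 3) - a * Y * (1 / (√2 * m)) := by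
        rw [hforce, ← hlin, ← hcub]
    _ = _ := by ring

end EulerLagrangeODE

theorem eventually_forall_abs_le_of_eventually_prod_nhds {ι : Type*} {F : Filter ι}
    {h : ι → ℝ} {P : ι × ℝ → Prop} (hh : Tendsto h F (𝓝 0))
    (hP : ∀ᶠ p in F ×ˢ 𝓝 ξ, P p) (R : ℝ) :
    ∀ᶠ i in F, ∀ s, |s| ≤ R → P (i, ξ + h i * s) := by
  have hbdd : IsBoundedUnder (· ≤ ·) (F ×ˢ 𝓟 {s : ℝ | |s| ≤ R})
      (norm ∘ (Prod.snd : ι × ℝ → ℝ)) :=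
    isBoundedUnder_of_eventually_le (a := R) (tendsto_snd (mem_principal_self _))
  have htend : Tendsto (fun p : ι × ℝ => (p.1, ξ + h p.1 * p.2))
      (F ×ˢ 𝓟 {s : ℝ | |s| ≤ R}) (F ×ˢ 𝓝 ξ) := by
    refine tendsto_fst.prodMk ?_
    simpa only [add_zero, Function.comp_apply] using
      ((hh.comp tendsto_fst).zero_mul_isBoundedUnder_le hbdd).const_add ξ
  exact eventually_prod_principal_iff.1 (htend.eventually hP)

theorem eventually_forall_abs_sub_sub_le {ι : Type*} {F : Filter ι} {h : ι → ℝ} {c δ : ℝ}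
    (hμ : HasDerivAt μ c ξ) (hh : Tendsto h F (𝓝 0)) (hδ : 0 < δ) (R : ℝ) :
    ∀ᶠ i in F, ∀ s, |s| ≤ R → |μ (ξ + h i * s) - μ ξ - h i * s * c| ≤ δ * |h i| := by
  have hlittle := (hasDerivAt_iff_isLittleO.1 hμ).def (div_pos hδ (by positivity : 0 < |R| + 1))
  filter_upwards [eventually_forall_abs_le_of_eventually_prod_nhds hh
    (hlittle.prod_inr F) R] with i hi s hs
  refine (by simpa [mul_assoc] using hi s hs : _ ≤ δ / (|R| + 1) * (|h i| * |s|)).trans ?_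
  rw [div_mul_eq_mul_div, div_le_iff₀ (by positivity), mul_assoc]
  have hs' : |s| ≤ |R| + 1 := by linarith [le_abs_self R]
  gcongr

theorem abs_painleve_sub_le {A B s w δ : ℝ} (hw : 0 ≤ w) (hA : |A - s| ≤ δ)
    (hB : |B - β| ≤ δ) :
    |A * w + 2 * w ^ 3 - B - (s * w + 2 * w ^ 3 - β)| ≤ δ * (1 + w) := by
  calc |A * w + 2 * w ^ 3 - B - (s * w + 2 * w ^ 3 - β)|
      = |(A - s) * w - (B - β)| := by congr 1; ring
    _ ≤ |A - s| * w + |B - β| := by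
        simpa only [abs_mul, abs_of_nonneg hw] using abs_sub ((A - s) * w) (B - β)
    _ ≤ δ * w + δ := by gcongr
    _ = δ * (1 + w) := by ring

theorem approxPainleveODE_rescaledProfile {v : ℝ → ℝ → ℝ} (hμξ : μ ξ = 0)
    (hμ' : deriv μ ξ < 0) (hf : ContinuousAt f ξ)
    (hv : ∀ᶠ ε in 𝓝[>] (0 : ℝ), ∃ z, EulerLagrangeODE μ f a ε (v ε) z)
    (hpos : ∀ᶠ p : ℝ × ℝ in 𝓝[>] 0 ×ˢ 𝓝 ξ, 0 ≤ v p.1 p.2) :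
    ApproxPainleveODE (𝓝[>] (0 : ℝ)) (a * f ξ / (√2 * -deriv μ ξ))
      (fun ε => rescaledProfile μ ξ 1 ε (v ε)) (fun ε => deriv (rescaledProfile μ ξ 1 ε (v ε)))
      (fun ε => deriv (deriv (rescaledProfile μ ξ 1 ε (v ε)))) := by
  intro R δ hδ
  have hμd := (differentiableAt_of_deriv_ne_zero hμ'.ne).hasDerivAt
  rw [← neg_neg (deriv μ ξ)] at hμd
  simp only [rescaledProfile_one]
  have hm : 0 < -deriv μ ξ := neg_pos.2 hμ'
  generalize -deriv μ ξ = m at hm hμd ⊢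
  have hlength := tendsto_layerLength m
  have hforce : ∀ᶠ x in 𝓝 ξ, |a * f x / (√2 * m) - a * f ξ / (√2 * m)| < δ := by
    have hcont : ContinuousAt (fun x => a * f x / (√2 * m)) ξ := by fun_prop
    exact hcont.eventually (Metric.ball_mem_nhds _ hδ)
  filter_upwards [hv, self_mem_nhdsWithin,
    eventually_forall_abs_le_of_eventually_prod_nhds hlength hpos R,
    eventually_forall_abs_le_of_eventually_prod_nhds hlength (hforce.prod_inr _) R,
    eventually_forall_abs_sub_sub_le hμd hlength (mul_pos hδ hm) R]
    with ε ⟨z, hz⟩ hε hposε hforceε hslope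
  have hh := layerLength_pos hm hε
  have hκ := layerFactor_pos hm hε
  have hw₁ := hz.hasDerivAt_rescale (layerFactor m ε) (layerLength m ε) ξ
  have hw₂ := hz.hasDerivAt_deriv_rescale (ne_of_gt hε) hm.ne' (mul_layerLength_pow_three hm hε)
    (sqrt_two_mul_mul_layerFactor hm hε) ξ
  rw [funext fun s => (hw₁ s).deriv, funext fun s => (hw₂ s).deriv]
  refine ⟨fun s hs => mul_nonneg hκ.le (hposε s hs), fun s _ => hw₁ s, fun s _ => hw₂ s,
    fun s hs => abs_painleve_sub_le (mul_nonneg hκ.le (hposε s hs)) ?_ (hforceε s hs).le⟩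
  have hquot : -(μ (ξ + layerLength m ε * s) / (m * layerLength m ε)) - s =
      -(μ (ξ + layerLength m ε * s) - μ ξ - layerLength m ε * s * -m) / (m * layerLength m ε) := by
    rw [hμξ]; field_simp; ring
  rw [hquot, abs_div, abs_neg, abs_of_pos (mul_pos hm hh), div_le_iff₀ (mul_pos hm hh)]
  simpa only [abs_of_pos hh, mul_assoc] using hslope s hs

theorem EulerLagrangeODE.contDiff_rescaledProfile (hv : EulerLagrangeODE μ f a ε v z)
    (ξ σ : ℝ) : ContDiff ℝ 1 (rescaledProfile μ ξ σ ε v) := by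
  have hvc : ContDiff ℝ 1 v := contDiff_one_of_hasDerivAt hv.hasDerivAt
    (continuous_iff_continuousAt.2 fun x => (hv.hasDerivAt_deriv x).continuousAt)
  unfold rescaledProfile
  fun_prop

theorem tendstoC1Loc_rescaledProfile {v : ℝ → ℝ → ℝ} {y : ℝ → ℝ} (hμξ : μ ξ = 0)
    (hμ' : deriv μ ξ < 0) (hf : ContinuousAt f ξ) (haf : 0 < a * f ξ)
    (hv : ∀ᶠ ε in 𝓝[>] (0 : ℝ), ∃ z, EulerLagrangeODE μ f a ε (v ε) z)
    (hpos : ∀ᶠ p : ℝ × ℝ in 𝓝[>] 0 ×ˢ 𝓝 ξ, 0 ≤ v p.1 p.2)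
    (hy : PainleveODE (a * f ξ / (√2 * -deriv μ ξ)) y z) (hy₀ : ∀ s, 0 ≤ y s) :
    TendstoC1Loc (fun ε => rescaledProfile μ ξ 1 ε (v ε)) y := by
  have hβ : 0 < a * f ξ / (√2 * -deriv μ ξ) := by
    have hm := neg_pos.2 hμ'
    positivity
  obtain ⟨hlim, hlim'⟩ := (approxPainleveODE_rescaledProfile hμξ hμ' hf hv
    hpos).tendstoLocallyUniformly hβ hy hy₀
  exact ⟨contDiff_one_of_hasDerivAt hy.hasDerivAt hy.continuous_deriv,
    hv.mono fun ε ⟨_, hz⟩ => hz.contDiff_rescaledProfile ξ 1, hlim, hy.deriv_eq ▸ hlim'⟩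

end Rescaling

theorem mainTheorem4_general (μ f : ℝ → ℝ) (ξ a : ℝ) (hξ : 0 < ξ) (hμξ : μ ξ = 0)
    (hμ' : deriv μ ξ < 0) (hμ_even : ∀ x, μ (-x) = μ x) (hf : ContinuousAt f ξ)
    (hf_odd : ∀ x, f (-x) = -f x) (haf : 0 < a * f ξ) :
    ∃ y : ℝ → ℝ, IsPositiveDecreasingPainleve (a * f ξ / (√2 * deriv μ ξ)) y ∧
      (∀ y₂ : ℝ → ℝ, IsPainleveIISolution (a * f ξ / (√2 * deriv μ ξ)) y₂ →
        (∀ s, 0 ≤ y₂ s) → y₂ = y) ∧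
      (∀ v : ℝ → ℝ → ℝ,
        (∀ᶠ ε in 𝓝[>] (0 : ℝ),
          (∃ z, EulerLagrangeODE μ f a ε (v ε) z) ∧ ∀ x, 0 ≤ x → 0 ≤ v ε x) →
        TendstoC1Loc (fun ε => rescaledProfile μ ξ 1 ε (v ε)) y) ∧
      (∀ v : ℝ → ℝ → ℝ,
        (∀ᶠ ε in 𝓝[>] (0 : ℝ),
          (∃ z, EulerLagrangeODE μ f a ε (v ε) z) ∧ ∀ x, x ≤ 0 → v ε x ≤ 0) →
        TendstoC1Loc (fun ε => rescaledProfile μ ξ (-1) ε (v ε)) y) := by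
  have hβ : 0 < a * f ξ / (√2 * -deriv μ ξ) := by
    have hm := neg_pos.2 hμ'
    positivity
  have hα : a * f ξ / (√2 * deriv μ ξ) = -(a * f ξ / (√2 * -deriv μ ξ)) := by
    rw [mul_neg, div_neg, neg_neg]
  obtain ⟨y, z, hyz, hy⟩ := exists_nonneg_painleveODE hβ
  have hplus : ∀ v : ℝ → ℝ → ℝ, (∀ᶠ ε in 𝓝[>] (0 : ℝ),
      (∃ z, EulerLagrangeODE μ f a ε (v ε) z) ∧ ∀ x, 0 ≤ x → 0 ≤ v ε x) →
      TendstoC1Loc (fun ε => rescaledProfile μ ξ 1 ε (v ε)) y := fun v hv =>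
    tendstoC1Loc_rescaledProfile hμξ hμ' hf haf (hv.mono fun _ h => h.1)
      ((hv.prod_mk (lt_mem_nhds hξ)).mono fun _ h => h.1.2 _ h.2.le) hyz hy
  refine ⟨y, hα ▸ hyz.isPositiveDecreasing hβ hy, fun y₂ hy₂ hy₂_nonneg => ?_, hplus,
    fun v hv => ?_⟩
  · rw [hα] at hy₂
    exact hyz.eq_of_nonneg hβ hy (by simpa only [neg_neg] using hy₂.painleveODE) hy₂_nonneg
  · simp only [rescaledProfile_neg_one]
    refine hplus _ (hv.mono fun ε ⟨⟨z, hz⟩, hneg⟩ =>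
      ⟨⟨_, hz.neg_comp_neg hμ_even hf_odd⟩, fun x hx => ?_⟩)
    exact neg_nonneg.2 (hneg (-x) (neg_nonpos.2 hx))

theorem mainTheorem4 (μ f : ℝ → ℝ) (ξ a : ℝ) (hdata : AdmissibleData μ f ξ) (ha : 0 < a) :
    (∃! y : ℝ → ℝ, IsPositiveDecreasingPainleve (a * f ξ / (√2 * deriv μ ξ)) y) ∧
    ∀ y : ℝ → ℝ, IsPositiveDecreasingPainleve (a * f ξ / (√2 * deriv μ ξ)) y →
      (∀ v : ℝ → ℝ → ℝ,
        (∀ᶠ ε in 𝓝[>] (0 : ℝ), IsGlobalMinimizer μ f a ε (v ε) ∧ ∀ x, 0 ≤ x → 0 ≤ v ε x) →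
        TendstoC1Loc (fun ε => rescaledProfile μ ξ 1 ε (v ε)) y) ∧
      (∀ v : ℝ → ℝ → ℝ,
        (∀ᶠ ε in 𝓝[>] (0 : ℝ), IsGlobalMinimizer μ f a ε (v ε) ∧ ∀ x, x ≤ 0 → v ε x ≤ 0) →
        TendstoC1Loc (fun ε => rescaledProfile μ ξ (-1) ε (v ε)) y) := by
  obtain ⟨y, hy, hunique, hplus, hminus⟩ := mainTheorem4_general μ f ξ a hdata.xi_pos
    hdata.mu_xi (hdata.deriv_mu_neg ξ hdata.xi_pos) hdata.even_mu hdata.continuous_f.continuousAt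
    hdata.odd_f (mul_pos ha (hdata.f_pos ξ hdata.xi_pos))
  have hunique' : ∀ y₂, IsPositiveDecreasingPainleve _ y₂ → y₂ = y := fun y₂ hy₂ =>
    hunique y₂ hy₂.minimal.1 fun s => (hy₂.pos s).le
  have hEL : ∀ᶠ ε in 𝓝[>] (0 : ℝ), ∀ v, IsGlobalMinimizer μ f a ε v →
      ∃ z, EulerLagrangeODE μ f a ε v z := by
    filter_upwards [self_mem_nhdsWithin] with ε hε v hv
    exact hv.exists_eulerLagrangeODE hdata.contDiff_mu.continuous hdata.bounded_mu
      hdata.continuous_f hdata.integrable_f (ne_of_gt hε)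
  refine ⟨⟨y, hy, hunique'⟩, fun y₂ hy₂ => ?_⟩
  rw [hunique' y₂ hy₂]
  exact ⟨fun v hv => hplus v ((hEL.and hv).mono fun _ h => ⟨h.1 _ h.2.1, h.2.2⟩),
    fun v hv => hminus v ((hEL.and hv).mono fun _ h => ⟨h.1 _ h.2.1, h.2.2⟩)⟩
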